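/- Let $k>0$ and let $\Phi_k(x,y):=\frac{i}{4}H^{(1)}_0(k|x-y|)$, $x,y\in\mathbb{R}^2$, $x\neq y$, where $H^{(1)}_0=J_0+iY_0$ is the Hankel function of the first kind of order zero. For $H\in\mathbb{R}$ let $\Gamma_H:=\{x=(x_1,x_2)\in\mathbb{R}^2: x_2=H\}$, let $\nu=(0,1)$ be its upward unit normal, and let $\mathbb{S}^1_+:=\{\hat x\in\mathbb{R}^2: |\hat x|=1,\ \hat x_2>0\}$. Then for every $H\in\mathbb{R}$ and all $y,z\in\mathbb{R}^2$ with $y_2<H$ and $z_2<H$, the integral over $\Gamma_H$ below converges absolutely and $$\int_{\Gamma_H}\left(\frac{\partial\Phi_k(x,y)}{\partial\nu(x)}\,\overline{\Phi_k(x,z)}-\Phi_k(x,y)\,\frac{\partial\overline{\Phi_k(x,z)}}{\partial\nu(x)}\right)ds(x)=\frac{i}{4\pi}\int_{\mathbb{S}^1_+}e^{ik\hat x\cdot(z-y)}\,ds(\hat x),$$ where $ds$ denotes arc length. -/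

import Mathlib

open MeasureTheory
open scoped ComplexConjugate

namespace Helmholtz2D

/-- The Euclidean plane `ℝ²`; the coordinates of `x` are `x 0` and `x 1` (called `x₁` and `x₂` in
print). -/
abbrev Plane : Type := EuclideanSpace ℝ (Fin 2)

/-- The Bessel function of the first kind of order zero,
`J₀(t) = ∑_{p ≥ 0} (-1)^p / (p!)² (t/2)^{2p}`. -/
noncomputable def besselJ0 (t : ℝ) : ℝ :=
  ∑' p : ℕ, (-1 : ℝ) ^ p / (p.factorial : ℝ) ^ 2 * (t / 2) ^ (2 * p)

/-- The Bessel function of the second kind (Neumann function) of order zero, for `t > 0`: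
`Y₀(t) = (2/π) ((log (t/2) + γ) J₀(t) - ∑_{p ≥ 0} (-1)^p h_p / (p!)² (t/2)^{2p})`,
with `γ` the Euler–Mascheroni constant and `h_p = 1 + 1/2 + ⋯ + 1/p` (so `h_0 = 0`). -/
noncomputable def besselY0 (t : ℝ) : ℝ :=
  2 / Real.pi * ((Real.log (t / 2) + Real.eulerMascheroniConstant) * besselJ0 t -
    ∑' p : ℕ, (-1 : ℝ) ^ p * ((harmonic p : ℚ) : ℝ) / (p.factorial : ℝ) ^ 2 * (t / 2) ^ (2 * p))

/-- The Hankel function of the first kind of order zero, `H₀⁽¹⁾ = J₀ + i Y₀`, for `t > 0`. -/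
noncomputable def hankelH0 (t : ℝ) : ℂ :=
  (besselJ0 t : ℂ) + Complex.I * (besselY0 t : ℂ)

/-- The fundamental solution `Φ_k(x, y) = (i/4) H₀⁽¹⁾(k |x - y|)`, `x ≠ y`, of the Helmholtz
equation in the plane. -/
noncomputable def Phi (k : ℝ) (x y : Plane) : ℂ :=
  Complex.I / 4 * hankelH0 (k * ‖x - y‖)

/-- The horizontal line `Γ_H = {x | x₂ = H}`. -/
def line (H : ℝ) : Set Plane := {x | x 1 = H}

/-- The unit normal of a horizontal line that points upwards, into `{x | x₂ > H}`. -/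
noncomputable def nu : Plane := !₂[0, 1]

/-- The derivative of `u` at `x` in the direction of the upward unit normal. -/
noncomputable def normalDeriv (u : Plane → ℂ) (x : Plane) : ℂ :=
  fderiv ℝ u x nu

/-- `t ↦ (t, H)`, `t ∈ ℝ`: a parametrization of `line H`. -/
noncomputable def lineCurve (H t : ℝ) : Plane := !₂[t, H]

/-- `θ ↦ (cos θ, sin θ)`: for `0 < θ < π` a parametrization of the upper half
`{x | |x| = 1, x₂ > 0}` of the unit circle. -/
noncomputable def circleCurve (θ : ℝ) : Plane := !₂[Real.cos θ, Real.sin θ]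

/-- The integral `∫ F ds` with respect to arc length along an injectively parametrized `C¹` curve
`γ : s → ℝ²`. -/
noncomputable def arcIntegral (γ : ℝ → Plane) (s : Set ℝ) (F : Plane → ℂ) : ℂ :=
  ∫ t in s, ‖deriv γ t‖ • F (γ t)

/-- Absolute integrability of `F` with respect to arc length along the curve `γ : s → ℝ²`. -/
def ArcIntegrable (γ : ℝ → Plane) (s : Set ℝ) (F : Plane → ℂ) : Prop :=
  IntegrableOn (fun t => ‖deriv γ t‖ • F (γ t)) s

/-- The integrand `∂_ν Φ_k(·, y) conj(Φ_k(·, z)) - Φ_k(·, y) ∂_ν conj(Φ_k(·, z))`. -/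
noncomputable def kirchhoffIntegrand (k : ℝ) (y z x : Plane) : ℂ :=
  normalDeriv (fun w => Phi k w y) x * conj (Phi k x z) -
    Phi k x y * normalDeriv (fun w => conj (Phi k w z)) x

end Helmholtz2D

/-!
The identity is proved by expanding the fundamental solution into plane waves. With lengths measured
in units of `1 / k`, for a source at the origin and a field point `(a, h)` with `h > 0`,

  `π H₀⁽¹⁾(√(a² + h²)) = ∫ e^{i (a ξ + β(ξ) h)} / β(ξ) dξ`, `β(ξ) = √(1 - ξ²)`, `Im β ≥ 0`.

The substitutions `ξ = sin θ` for `|ξ| < 1` and `ξ = ± cosh t` for `|ξ| > 1` remove the singularities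
of the integrand; the right-hand side becomes `planeWaveSum a h`, an integral of propagating waves
over all upward directions plus an integral of evanescent waves.

To see that this sum is the Hankel function given by power series, differentiate it along a circle:
the derivative is a total derivative in the wave parameter, so the sum is radial
(`planeWaveSum_eq_radial`). On the vertical axis it satisfies Bessel's equation
(`solvesBessel_planeWaveSum`), as the series does (`solvesBessel_hankelH0`), and both have the same
logarithmic singularity at the origin, where Euler's constant enters through `Γ'(1) = -γ`. A solution
of Bessel's equation that vanishes with its derivative at the origin has zero energy
(`SolvesBessel.eq_zero`), hence the two agree (`planeWaveSum_eq_hankelH0`).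

A second energy estimate (`SolvesBessel.exists_decay`) shows that the normal derivative of the field
is integrable along horizontal lines. Fourier inversion then gives its horizontal Fourier transform
`2πi e^{i β(ξ) h}` (`integral_planeWaveSumDeriv_mul_exp`), and Fubini's theorem evaluates the pairing
of the normal derivative of one field with the conjugate of another one
(`integral_planeWaveSumDeriv_mul_conj`). In the antisymmetric combination of the Kirchhoff integrand
the evanescent waves cancel, and the propagating waves leave the integral over the upper half circle
(`integral_planeWaveSum_antisymm`).
-/

namespace Helmholtz2D

open Filter Topology Set

/-! ### Entire power series and the Bessel functions of order zero -/

/-- The sum of the real power series with coefficients `c`. -/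
noncomputable def powerSum (c : ℕ → ℝ) (x : ℝ) : ℝ := ∑' p, c p * x ^ p

/-- The coefficients of the termwise derivative. -/
def derivCoeff (c : ℕ → ℝ) (p : ℕ) : ℝ := (p + 1) * c (p + 1)

lemma summable_powerSum {c : ℕ → ℝ} (hc : ∀ p, |c p| ≤ 1 / (p.factorial : ℝ)) (x : ℝ) :
    Summable fun p => c p * x ^ p := by
  refine Summable.of_norm_bounded (Real.summable_pow_div_factorial |x|) fun p => ?_
  rw [norm_mul, norm_pow, Real.norm_eq_abs, Real.norm_eq_abs]
  calc |c p| * |x| ^ p ≤ 1 / (p.factorial : ℝ) * |x| ^ p := by gcongr; exact hc p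
    _ = |x| ^ p / p.factorial := by ring

/-- The bound `|c p| ≤ 1 / p!` is stable under termwise differentiation, so that it serves as
majorant for all derivatives at once. -/
lemma abs_derivCoeff_le {c : ℕ → ℝ} (hc : ∀ p, |c p| ≤ 1 / (p.factorial : ℝ)) (p : ℕ) :
    |derivCoeff c p| ≤ 1 / (p.factorial : ℝ) := by
  have h1 : (0 : ℝ) < p + 1 := by positivity
  rw [derivCoeff, abs_mul, abs_of_pos h1]
  calc ((p : ℝ) + 1) * |c (p + 1)| ≤ (p + 1) * (1 / ((p + 1).factorial : ℝ)) := by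
        gcongr; exact hc _
    _ = 1 / (p.factorial : ℝ) := by
        rw [Nat.factorial_succ]; push_cast; field_simp

lemma hasDerivAt_powerSum {c : ℕ → ℝ} (hc : ∀ p, |c p| ≤ 1 / (p.factorial : ℝ)) (x : ℝ) :
    HasDerivAt (powerSum c) (powerSum (derivCoeff c) x) x := by
  set R := |x| + 1
  have hu : Summable fun n : ℕ => (n : ℝ) * R ^ (n - 1) / n.factorial := by
    rw [← summable_nat_add_iff 1]
    refine (Real.summable_pow_div_factorial R).congr fun n => ?_
    rw [Nat.factorial_succ]; push_cast; field_simp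
  have hx : x ∈ Metric.ball (0 : ℝ) R := by simp [R]
  have key := hasDerivAt_tsum_of_isPreconnected (g := fun (p : ℕ) (y : ℝ) => c p * y ^ p)
    (g' := fun (p : ℕ) (y : ℝ) => c p * (p * y ^ (p - 1))) (y := x) hu Metric.isOpen_ball
    (convex_ball (0 : ℝ) R).isPreconnected
    (fun n y _ => (hasDerivAt_pow n y).const_mul (c n)) (fun n y hy => ?_)
    hx (summable_powerSum hc x) hx
  · have hs : Summable fun p : ℕ => c p * (p * x ^ (p - 1)) := by
      rw [← summable_nat_add_iff 1]
      refine (summable_powerSum (abs_derivCoeff_le hc) x).congr fun p => ?_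
      simp only [derivCoeff, Nat.add_sub_cancel]; push_cast; ring
    have he : (∑' p : ℕ, c p * (p * x ^ (p - 1))) = powerSum (derivCoeff c) x := by
      rw [hs.tsum_eq_zero_add]
      simp only [powerSum, derivCoeff, Nat.add_sub_cancel]
      simp only [CharP.cast_eq_zero, zero_mul, mul_zero, zero_add]
      exact tsum_congr fun p => by push_cast; ring
    rw [he] at key
    exact key
  · have hy' : |y| ≤ R := by simpa using (mem_ball_zero_iff.1 hy).le
    rw [norm_mul, norm_mul, norm_pow, Real.norm_eq_abs, Real.norm_eq_abs, Real.norm_eq_abs,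
      Nat.abs_cast]
    calc |c n| * (n * |y| ^ (n - 1)) ≤ 1 / (n.factorial : ℝ) * (n * R ^ (n - 1)) := by
          gcongr; exact hc n
      _ = n * R ^ (n - 1) / n.factorial := by ring

/-- Coefficients of `J₀` in the variable `(t/2)²`. -/
noncomputable def coeffJ (p : ℕ) : ℝ := (-1 : ℝ) ^ p / (p.factorial : ℝ) ^ 2

/-- Coefficients, in the variable `(t/2)²`, of the power series that enters `Y₀`. -/
noncomputable def coeffY (p : ℕ) : ℝ :=
  (-1 : ℝ) ^ p * ((harmonic p : ℚ) : ℝ) / (p.factorial : ℝ) ^ 2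

lemma abs_coeffJ_le (p : ℕ) : |coeffJ p| ≤ 1 / (p.factorial : ℝ) := by
  have h1 : (1 : ℝ) ≤ p.factorial := by exact_mod_cast p.factorial_pos
  rw [coeffJ, abs_div, abs_pow, abs_neg, abs_one, one_pow, abs_of_pos (by positivity)]
  gcongr
  nlinarith

lemma harmonic_le_factorial (p : ℕ) : harmonic p ≤ (p.factorial : ℚ) := by
  induction p with
  | zero => simp
  | succ n ih =>
    rw [harmonic_succ, Nat.factorial_succ]
    have h1 : (1 : ℚ) ≤ n.factorial := by exact_mod_cast n.factorial_pos
    rcases Nat.eq_zero_or_pos n with rfl | hn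
    · simp
    · have h2 : (1 : ℚ) ≤ n := by exact_mod_cast hn
      have h3 : ((n : ℚ) + 1)⁻¹ ≤ 1 := inv_le_one_of_one_le₀ (by linarith)
      push_cast
      nlinarith

lemma abs_coeffY_le (p : ℕ) : |coeffY p| ≤ 1 / (p.factorial : ℝ) := by
  have h1 : (0 : ℝ) < p.factorial := by exact_mod_cast p.factorial_pos
  have h2 : ((harmonic p : ℚ) : ℝ) ≤ p.factorial := by exact_mod_cast harmonic_le_factorial p
  have h3 : (0 : ℝ) ≤ ((harmonic p : ℚ) : ℝ) := by
    have : (0 : ℚ) ≤ harmonic p := by unfold harmonic; positivity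
    exact_mod_cast this
  rw [coeffY, abs_div, abs_mul, abs_pow, abs_neg, abs_one, one_pow, one_mul, abs_of_nonneg h3,
    abs_of_pos (by positivity), div_le_div_iff₀ (by positivity) h1]
  nlinarith

lemma besselJ0_eq (t : ℝ) : besselJ0 t = powerSum coeffJ ((t / 2) ^ 2) := by
  simp only [besselJ0, powerSum, coeffJ, pow_mul]

lemma besselY0_eq (t : ℝ) : besselY0 t = 2 / Real.pi *
    ((Real.log (t / 2) + Real.eulerMascheroniConstant) * powerSum coeffJ ((t / 2) ^ 2) -
      powerSum coeffY ((t / 2) ^ 2)) := by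
  rw [besselY0, besselJ0_eq]
  simp only [powerSum, coeffY, pow_mul]

lemma powerSum_coeff_zero (c : ℕ → ℝ) : powerSum c 0 = c 0 := by
  rw [powerSum, tsum_eq_single 0 fun p hp => by simp [hp]]; simp

/-- With `x = (t/2)²` Bessel's equation for `J₀` becomes `x A'' + A' + A = 0`. -/
lemma powerSum_coeffJ_ode (x : ℝ) :
    x * powerSum (derivCoeff (derivCoeff coeffJ)) x + powerSum (derivCoeff coeffJ) x +
      powerSum coeffJ x = 0 := by
  have h0 := abs_coeffJ_le
  have h1 := abs_derivCoeff_le h0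
  have e1 : powerSum (derivCoeff coeffJ) x = derivCoeff coeffJ 0 +
      ∑' p, derivCoeff coeffJ (p + 1) * x ^ (p + 1) := by
    rw [powerSum, (summable_powerSum h1 x).tsum_eq_zero_add]; simp
  have e0 : powerSum coeffJ x = coeffJ 0 + ∑' p, coeffJ (p + 1) * x ^ (p + 1) := by
    rw [powerSum, (summable_powerSum h0 x).tsum_eq_zero_add]; simp
  have e2 : x * powerSum (derivCoeff (derivCoeff coeffJ)) x =
      -(∑' p, derivCoeff coeffJ (p + 1) * x ^ (p + 1)) - ∑' p, coeffJ (p + 1) * x ^ (p + 1) := by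
    rw [powerSum, ← tsum_mul_left, ← tsum_neg, ← Summable.tsum_sub]
    · refine tsum_congr fun p => ?_
      simp only [derivCoeff, coeffJ, Nat.factorial_succ, pow_succ]
      push_cast
      have : (p.factorial : ℝ) ≠ 0 := by exact_mod_cast p.factorial_ne_zero
      field_simp
      ring
    · exact ((summable_nat_add_iff 1).2 (summable_powerSum h1 x)).neg
    · exact (summable_nat_add_iff 1).2 (summable_powerSum h0 x)
  rw [e2, e1, e0]
  simp [derivCoeff, coeffJ]
  ring

/-- The inhomogeneous companion `x B'' + B' + B = A'` of `powerSum_coeffJ_ode`. -/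
lemma powerSum_coeffY_ode (x : ℝ) :
    x * powerSum (derivCoeff (derivCoeff coeffY)) x + powerSum (derivCoeff coeffY) x +
      powerSum coeffY x = powerSum (derivCoeff coeffJ) x := by
  have h0 := abs_coeffY_le
  have h1 := abs_derivCoeff_le h0
  have k1 := abs_derivCoeff_le abs_coeffJ_le
  have e1 : powerSum (derivCoeff coeffY) x = derivCoeff coeffY 0 +
      ∑' p, derivCoeff coeffY (p + 1) * x ^ (p + 1) := by
    rw [powerSum, (summable_powerSum h1 x).tsum_eq_zero_add]; simp
  have e0 : powerSum coeffY x = coeffY 0 + ∑' p, coeffY (p + 1) * x ^ (p + 1) := by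
    rw [powerSum, (summable_powerSum h0 x).tsum_eq_zero_add]; simp
  have ek : powerSum (derivCoeff coeffJ) x = derivCoeff coeffJ 0 +
      ∑' p, derivCoeff coeffJ (p + 1) * x ^ (p + 1) := by
    rw [powerSum, (summable_powerSum k1 x).tsum_eq_zero_add]; simp
  have s1 := (summable_nat_add_iff 1).2 (summable_powerSum h1 x)
  have s0 := (summable_nat_add_iff 1).2 (summable_powerSum h0 x)
  have sk := (summable_nat_add_iff 1).2 (summable_powerSum k1 x)
  have e2 : x * powerSum (derivCoeff (derivCoeff coeffY)) x =
      (∑' p, derivCoeff coeffJ (p + 1) * x ^ (p + 1)) -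
      (∑' p, derivCoeff coeffY (p + 1) * x ^ (p + 1)) -
        ∑' p, coeffY (p + 1) * x ^ (p + 1) := by
    rw [powerSum, ← tsum_mul_left, ← sk.tsum_sub s1, ← (sk.sub s1).tsum_sub s0]
    refine tsum_congr fun p => ?_
    simp only [derivCoeff, coeffJ, coeffY, Nat.factorial_succ, pow_succ, harmonic_succ]
    push_cast
    have : (p.factorial : ℝ) ≠ 0 := by exact_mod_cast p.factorial_ne_zero
    have : (p : ℝ) + 1 ≠ 0 := by positivity
    have : (p : ℝ) + 1 + 1 ≠ 0 := by positivity
    field_simp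
    ring
  rw [e2, e1, e0, ek]
  simp [derivCoeff, coeffJ, coeffY, harmonic_succ]
  ring

/-! ### Bessel's equation and its energies -/

/-- `f` solves Bessel's equation `f'' + f' / r + f = 0` of order zero on `(0, ∞)`, with
derivative `f'`. -/
def SolvesBessel (f f' : ℝ → ℂ) : Prop :=
  ∀ r : ℝ, 0 < r → HasDerivAt f (f' r) r ∧ HasDerivAt f' (-f r - f' r / r) r

/-- The derivative of `H₀⁽¹⁾`, written with the power series. -/
noncomputable def hankelDeriv (r : ℝ) : ℂ :=
  ((powerSum (derivCoeff coeffJ) ((r / 2) ^ 2) * (r / 2) : ℝ) : ℂ) + Complex.I *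
    ((2 / Real.pi * (powerSum coeffJ ((r / 2) ^ 2) / r +
      ((Real.log (r / 2) + Real.eulerMascheroniConstant) *
        powerSum (derivCoeff coeffJ) ((r / 2) ^ 2) -
        powerSum (derivCoeff coeffY) ((r / 2) ^ 2)) * (r / 2)) : ℝ) : ℂ)

lemma hasDerivAt_powerSum_half_sq {c : ℕ → ℝ} (hc : ∀ p, |c p| ≤ 1 / (p.factorial : ℝ)) (r : ℝ) :
    HasDerivAt (fun r => powerSum c ((r / 2) ^ 2))
      (powerSum (derivCoeff c) ((r / 2) ^ 2) * (r / 2)) r := by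
  have h1 : HasDerivAt (fun r : ℝ => (r / 2) ^ 2) (r / 2) r := by
    refine (((hasDerivAt_id r).div_const 2).pow 2).congr_deriv ?_
    simp; ring
  exact (hasDerivAt_powerSum hc _).comp r h1

lemma hasDerivAt_log_half {r : ℝ} (hr : 0 < r) :
    HasDerivAt (fun r => Real.log (r / 2) + Real.eulerMascheroniConstant) (1 / r) r := by
  refine ((((hasDerivAt_id r).div_const 2).log (by simp; positivity)).add_const
    Real.eulerMascheroniConstant).congr_deriv ?_
  simp; field_simp

/-- The power series definition satisfies Bessel's equation: the inhomogeneity of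
`powerSum_coeffY_ode` compensates the terms in which the logarithm is differentiated. -/
lemma solvesBessel_hankelH0 : SolvesBessel hankelH0 hankelDeriv := by
  intro r hr
  have a0 := hasDerivAt_powerSum_half_sq abs_coeffJ_le r
  have a1 := hasDerivAt_powerSum_half_sq (abs_derivCoeff_le abs_coeffJ_le) r
  have b0 := hasDerivAt_powerSum_half_sq abs_coeffY_le r
  have b1 := hasDerivAt_powerSum_half_sq (abs_derivCoeff_le abs_coeffY_le) r
  have hL := hasDerivAt_log_half hr
  have hid : HasDerivAt (fun r : ℝ => r / 2) (1 / 2) r := (hasDerivAt_id r).div_const 2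
  have oJ := powerSum_coeffJ_ode ((r / 2) ^ 2)
  have oY := powerSum_coeffY_ode ((r / 2) ^ 2)
  constructor
  · have hf : hankelH0 = fun r => ((powerSum coeffJ ((r / 2) ^ 2) : ℝ) : ℂ) + Complex.I *
        ((2 / Real.pi * ((Real.log (r / 2) + Real.eulerMascheroniConstant) *
          powerSum coeffJ ((r / 2) ^ 2) - powerSum coeffY ((r / 2) ^ 2)) : ℝ) : ℂ) := by
      funext r; rw [hankelH0, besselJ0_eq, besselY0_eq]
    rw [hf]
    refine a0.ofReal_comp.add (HasDerivAt.const_mul _ (HasDerivAt.ofReal_comp ?_))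
    refine (((hL.mul a0).sub b0).const_mul (2 / Real.pi)).congr_deriv ?_
    ring
  · have hJ := (a1.mul hid).ofReal_comp
    have hY := ((((a0.div (hasDerivAt_id r) hr.ne').add
      (((hL.mul a1).sub b1).mul hid)).const_mul (2 / Real.pi)).ofReal_comp).const_mul Complex.I
    refine (hJ.add hY).congr_deriv ?_
    rw [hankelH0, besselJ0_eq, besselY0_eq, hankelDeriv]
    simp only [id, Pi.mul_apply, Pi.sub_apply]
    clear hJ hY a0 a1 b0 b1 hL hid
    generalize powerSum (derivCoeff (derivCoeff coeffJ)) ((r / 2) ^ 2) = A2 at *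
    generalize powerSum (derivCoeff (derivCoeff coeffY)) ((r / 2) ^ 2) = B2 at *
    generalize powerSum (derivCoeff coeffJ) ((r / 2) ^ 2) = A1 at *
    generalize powerSum (derivCoeff coeffY) ((r / 2) ^ 2) = B1 at *
    generalize powerSum coeffJ ((r / 2) ^ 2) = A0 at *
    generalize powerSum coeffY ((r / 2) ^ 2) = B0 at *
    generalize Real.log (r / 2) + Real.eulerMascheroniConstant = L at *
    obtain rfl := eq_sub_of_add_eq' oJ
    obtain rfl := eq_sub_of_add_eq' oY
    have hr' : (r : ℂ) ≠ 0 := by exact_mod_cast hr.ne'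
    have hp : (Real.pi : ℂ) ≠ 0 := by exact_mod_cast Real.pi_ne_zero
    push_cast
    field_simp
    ring

/-- The energy `‖f‖² + ‖f'‖²` of a solution of Bessel's equation does not increase; a solution
that vanishes together with its derivative at `0` is therefore zero. -/
lemma SolvesBessel.eq_zero {f f' : ℝ → ℂ} (hf : SolvesBessel f f')
    (h0 : Tendsto f (𝓝[>] 0) (𝓝 0)) (h0' : Tendsto f' (𝓝[>] 0) (𝓝 0)) {r : ℝ} (hr : 0 < r) :
    f r = 0 := by
  set E : ℝ → ℝ := fun r => ‖f r‖ ^ 2 + ‖f' r‖ ^ 2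
  have hE : ∀ s, 0 < s → HasDerivAt E (-(2 / s) * ‖f' s‖ ^ 2) s := by
    intro s hs
    refine ((hf s hs).1.norm_sq.add (hf s hs).2.norm_sq).congr_deriv ?_
    have hdiv : f' s / (s : ℂ) = (s⁻¹ : ℝ) • f' s := by
      rw [Complex.real_smul]; push_cast; field_simp
    rw [hdiv, inner_sub_right, inner_neg_right, inner_smul_right, real_inner_self_eq_norm_sq,
      real_inner_comm]
    field_simp; ring
  have hanti : AntitoneOn E (Ioi 0) := by
    refine antitoneOn_of_deriv_nonpos (convex_Ioi 0)
      (fun s hs => (hE s hs).continuousAt.continuousWithinAt) (fun s hs => ?_) (fun s hs => ?_)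
    · rw [interior_Ioi] at hs ⊢; exact (hE s hs).differentiableAt.differentiableWithinAt
    · rw [interior_Ioi] at hs
      rw [(hE s hs).deriv]
      have : 0 < 2 / s := div_pos two_pos hs
      nlinarith [sq_nonneg ‖f' s‖]
  have hlim : Tendsto E (𝓝[>] 0) (𝓝 0) := by
    have := (h0.norm.pow 2).add (h0'.norm.pow 2)
    simpa using this
  have hle : E r ≤ 0 := by
    refine ge_of_tendsto hlim ?_
    filter_upwards [Ioo_mem_nhdsGT hr] with s hs
    exact hanti hs.1 hr hs.2.le
  have : ‖f r‖ ^ 2 ≤ 0 := by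
    have := sq_nonneg ‖f' r‖
    simp only [E] at hle; linarith
  simpa using this

/-- Solutions of Bessel's equation decay like `r ^ (-1/2)`, together with their derivatives. The
monotone quantity is `‖u'‖² + (1 + 1/(4r²)) ‖u‖²` for the normal form `u = √r f`, which satisfies
`u'' + (1 + 1/(4r²)) u = 0`. -/
lemma SolvesBessel.exists_decay {f f' : ℝ → ℂ} (hf : SolvesBessel f f') {r₀ : ℝ} (hr₀ : 0 < r₀) :
    ∃ C, ∀ r, r₀ ≤ r → r * ‖f r‖ ^ 2 ≤ C ∧ r * ‖f' r‖ ^ 2 ≤ C := by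
  -- The normal form energy, expressed through `f` and `f'` to avoid square roots.
  set E : ℝ → ℝ := fun r => r * (‖f r‖ ^ 2 + ‖f' r‖ ^ 2) + inner ℝ (f r) (f' r) +
    ‖f r‖ ^ 2 / (2 * r)
  have hE : ∀ s, 0 < s → HasDerivAt E (-(‖f s‖ ^ 2 / (2 * s ^ 2))) s := by
    intro s hs
    have e0 := (hf s hs).1.norm_sq
    have e1 := (hf s hs).2.norm_sq
    have e2 := (hf s hs).1.inner ℝ (hf s hs).2
    have e3 : HasDerivAt (fun s : ℝ => 2 * s) 2 s := by
      simpa using (hasDerivAt_id s).const_mul 2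
    refine ((((hasDerivAt_id s).mul (e0.add e1)).add e2).add
      (e0.div e3 (by positivity))).congr_deriv ?_
    have hdiv : f' s / (s : ℂ) = (s⁻¹ : ℝ) • f' s := by
      rw [Complex.real_smul]; push_cast; field_simp
    simp only [hdiv, inner_sub_right, inner_neg_right, inner_smul_right,
      real_inner_self_eq_norm_sq, real_inner_comm (f s) (f' s), id, Pi.add_apply]
    field_simp; ring
  have hanti : AntitoneOn E (Ioi 0) := by
    refine antitoneOn_of_deriv_nonpos (convex_Ioi 0)
      (fun s hs => (hE s hs).continuousAt.continuousWithinAt) (fun s hs => ?_) (fun s hs => ?_)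
    · rw [interior_Ioi] at hs ⊢; exact (hE s hs).differentiableAt.differentiableWithinAt
    · rw [interior_Ioi] at hs
      rw [(hE s hs).deriv]
      have : 0 ≤ ‖f s‖ ^ 2 / (2 * s ^ 2) := by positivity
      linarith
  refine ⟨2 * E r₀, fun r hr => ?_⟩
  have hr' : 0 < r := hr₀.trans_le hr
  have h1 : E r ≤ E r₀ := hanti hr₀ hr' hr
  have h2 : -(‖f r‖ * ‖f' r‖) ≤ inner ℝ (f r) (f' r) :=
    neg_le_of_abs_le (abs_real_inner_le_norm _ _)
  have h3 : ‖f r‖ * ‖f' r‖ ≤ r * ‖f' r‖ ^ 2 / 2 + ‖f r‖ ^ 2 / (2 * r) := by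
    have : 0 ≤ (r * ‖f' r‖ - ‖f r‖) ^ 2 / (2 * r) := by positivity
    have e : (r * ‖f' r‖ - ‖f r‖) ^ 2 / (2 * r) =
        r * ‖f' r‖ ^ 2 / 2 + ‖f r‖ ^ 2 / (2 * r) - ‖f r‖ * ‖f' r‖ := by field_simp; ring
    linarith
  have h4 : 0 ≤ r * ‖f r‖ ^ 2 := by positivity
  have h5 : 0 ≤ r * ‖f' r‖ ^ 2 := by positivity
  simp only [E] at h1 ⊢
  constructor <;> nlinarith

/-! ### Behaviour of the Hankel function at the origin -/

lemma tendsto_powerSum_half_sq {c : ℕ → ℝ} (hc : ∀ p, |c p| ≤ 1 / (p.factorial : ℝ)) :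
    Tendsto (fun r : ℝ => powerSum c ((r / 2) ^ 2)) (𝓝[>] 0) (𝓝 (c 0)) := by
  have h := (hasDerivAt_powerSum_half_sq hc 0).continuousAt.tendsto
  simp only [zero_div, ne_eq, OfNat.ofNat_ne_zero, not_false_eq_true, zero_pow,
    powerSum_coeff_zero] at h
  exact h.mono_left nhdsWithin_le_nhds

lemma tendsto_powerSum_coeffJ_slope :
    Tendsto (fun r : ℝ => (powerSum coeffJ ((r / 2) ^ 2) - 1) / r) (𝓝[>] 0) (𝓝 0) := by
  have h := hasDerivAt_iff_tendsto_slope.1 (hasDerivAt_powerSum_half_sq abs_coeffJ_le 0)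
  rw [zero_div, mul_zero] at h
  refine (h.mono_left (nhdsWithin_mono _ fun r hr => ne_of_gt hr)).congr fun r => ?_
  rw [slope_def_field]
  simp [powerSum_coeff_zero, coeffJ]

lemma tendsto_mul_log_half :
    Tendsto (fun r : ℝ => r * (Real.log (r / 2) + Real.eulerMascheroniConstant))
      (𝓝[>] 0) (𝓝 0) := by
  have h1 : Tendsto (fun r : ℝ => Real.log r * r) (𝓝[>] 0) (𝓝 0) := by
    simpa using tendsto_log_mul_rpow_nhdsGT_zero (r := 1) one_pos
  have h2 : Tendsto (fun r : ℝ => r * (Real.eulerMascheroniConstant - Real.log 2))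
      (𝓝[>] 0) (𝓝 0) := by
    have : Tendsto (fun r : ℝ => r * (Real.eulerMascheroniConstant - Real.log 2)) (𝓝 0)
        (𝓝 (0 * (Real.eulerMascheroniConstant - Real.log 2))) :=
      tendsto_id.mul_const _
    rw [zero_mul] at this
    exact this.mono_left nhdsWithin_le_nhds
  have h3 := h1.add h2
  rw [add_zero] at h3
  refine h3.congr' ?_
  filter_upwards [self_mem_nhdsWithin] with r hr
  rw [Real.log_div (ne_of_gt hr) two_ne_zero]
  ring

lemma tendsto_hankelH0_sub_log :
    Tendsto (fun r => hankelH0 r - 2 * Complex.I / Real.pi *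
      ((Real.log (r / 2) + Real.eulerMascheroniConstant : ℝ) : ℂ)) (𝓝[>] 0) (𝓝 1) := by
  have hA := tendsto_powerSum_half_sq abs_coeffJ_le
  have hB := tendsto_powerSum_half_sq abs_coeffY_le
  have hS := (tendsto_mul_log_half.mul tendsto_powerSum_coeffJ_slope).sub hB
  have hA' := (Complex.continuous_ofReal.tendsto _).comp hA
  have hS' := ((Complex.continuous_ofReal.tendsto _).comp hS).const_mul
    (2 * Complex.I / (Real.pi : ℂ))
  have h := hA'.add hS'
  have e : ((coeffJ 0 : ℝ) : ℂ) + 2 * Complex.I / Real.pi * ((0 * 0 - coeffY 0 : ℝ) : ℂ) = 1 := by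
    simp [coeffJ, coeffY]
  rw [e] at h
  refine h.congr' ?_
  filter_upwards [self_mem_nhdsWithin] with r (hr : 0 < r)
  have hr' : (r : ℂ) ≠ 0 := by exact_mod_cast hr.ne'
  rw [hankelH0, besselJ0_eq, besselY0_eq]
  simp only [Function.comp]
  push_cast
  field_simp
  ring

lemma tendsto_hankelDeriv_sub_inv :
    Tendsto (fun r : ℝ => hankelDeriv r - 2 * Complex.I / Real.pi * ((1 / r : ℝ) : ℂ))
      (𝓝[>] 0) (𝓝 0) := by
  have hr0 : Tendsto (fun r : ℝ => r) (𝓝[>] 0) (𝓝 0) := tendsto_id.mono_left nhdsWithin_le_nhds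
  have hA1 := tendsto_powerSum_half_sq (abs_derivCoeff_le abs_coeffJ_le)
  have hB1 := tendsto_powerSum_half_sq (abs_derivCoeff_le abs_coeffY_le)
  have hS := tendsto_powerSum_coeffJ_slope.add
    (((tendsto_mul_log_half.mul hA1).sub (hr0.mul hB1)).div_const 2)
  have hA' := (Complex.continuous_ofReal.tendsto _).comp ((hA1.mul hr0).div_const 2)
  have hS' := ((Complex.continuous_ofReal.tendsto _).comp hS).const_mul
    (2 * Complex.I / (Real.pi : ℂ))
  have h := hA'.add hS'
  simp only [mul_zero, zero_mul, zero_div, sub_zero, add_zero, Complex.ofReal_zero] at h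
  refine h.congr' ?_
  filter_upwards [self_mem_nhdsWithin] with r (hr : 0 < r)
  have hr' : (r : ℂ) ≠ 0 := by exact_mod_cast hr.ne'
  rw [hankelDeriv]
  simp only [Function.comp]
  push_cast
  field_simp
  ring

/-! ### Propagating and evanescent waves -/

/-- The plane wave `(a, h) ↦ e^{i (a sin θ + h cos θ)}` in the direction at angle `θ` from the
vertical. -/
noncomputable def propagatingWave (a h θ : ℝ) : ℂ :=
  Complex.exp (Complex.I * ((a * Real.sin θ + h * Real.cos θ : ℝ) : ℂ))

/-- The plane wave `(a, h) ↦ e^{i a cosh t - h sinh t}`, which decays in the vertical direction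
for `t > 0`. -/
noncomputable def evanescentWave (a h t : ℝ) : ℂ :=
  Complex.exp (Complex.I * ((a * Real.cosh t : ℝ) : ℂ) - ((h * Real.sinh t : ℝ) : ℂ))

lemma norm_propagatingWave (a h θ : ℝ) : ‖propagatingWave a h θ‖ = 1 := by
  rw [propagatingWave, Complex.norm_exp]; simp

lemma norm_evanescentWave (a h t : ℝ) :
    ‖evanescentWave a h t‖ = Real.exp (-(h * Real.sinh t)) := by
  rw [evanescentWave, Complex.norm_exp, Complex.sub_re, Complex.mul_re, Complex.ofReal_im,
    Complex.ofReal_re, Complex.ofReal_re, Complex.I_re]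
  simp

@[fun_prop]
lemma continuous_propagatingWave (a h : ℝ) : Continuous (propagatingWave a h) := by
  unfold propagatingWave; fun_prop

@[fun_prop]
lemma continuous_evanescentWave (a h : ℝ) : Continuous (evanescentWave a h) := by
  have := Real.continuous_cosh
  have := Real.continuous_sinh
  unfold evanescentWave; fun_prop

lemma conj_propagatingWave (a h θ : ℝ) :
    conj (propagatingWave a h θ) = propagatingWave (-a) (-h) θ := by
  simp only [propagatingWave, ← Complex.exp_conj, map_mul, Complex.conj_I, Complex.conj_ofReal]
  congr 1; push_cast; ring

lemma conj_evanescentWave (a h t : ℝ) :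
    conj (evanescentWave a h t) = evanescentWave (-a) h t := by
  simp only [evanescentWave, ← Complex.exp_conj, map_sub, map_mul, Complex.conj_I,
    Complex.conj_ofReal]
  congr 1; push_cast; ring

/-- For every power of `cosh` the factor `e^{-δ sinh t}` leaves the integrable majorant `e^{-t}`. -/
lemma exists_cosh_pow_mul_exp_le (n : ℕ) {δ : ℝ} (hδ : 0 < δ) :
    ∃ C, ∀ t, 0 ≤ t → Real.cosh t ^ n * Real.exp (-(δ * Real.sinh t)) ≤ C * Real.exp (-t) := by
  refine ⟨2 * (((n + 1).factorial : ℝ) / δ ^ (n + 1) * Real.exp δ), fun t ht => ?_⟩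
  have hc : 0 < Real.cosh t := Real.cosh_pos t
  have hs : 0 ≤ Real.sinh t := Real.sinh_nonneg_iff.2 ht
  -- One of the `n + 1` factors `cosh t` that the exponential absorbs pays for `e^t ≤ 2 cosh t`.
  have hcs : Real.cosh t ≤ 1 + Real.sinh t := by nlinarith [Real.cosh_sq t]
  have h1 : (δ * Real.cosh t) ^ (n + 1) / ((n + 1).factorial : ℝ) ≤ Real.exp (δ * Real.cosh t) :=
    Real.pow_div_factorial_le_exp _ (by positivity) _
  have h2 : Real.exp (δ * Real.cosh t) ≤ Real.exp δ * Real.exp (δ * Real.sinh t) := by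
    rw [← Real.exp_add]; exact Real.exp_le_exp.2 (by nlinarith)
  have h3 : Real.exp t ≤ 2 * Real.cosh t := by
    rw [Real.cosh_eq]; linarith [Real.exp_pos (-t)]
  have hf : (0 : ℝ) < (n + 1).factorial := by exact_mod_cast Nat.factorial_pos _
  have h4 : (δ * Real.cosh t) ^ (n + 1) ≤
      (n + 1).factorial * (Real.exp δ * Real.exp (δ * Real.sinh t)) := by
    have := h1.trans h2
    rw [div_le_iff₀ hf] at this
    linarith
  have h5 : Real.cosh t ^ n * Real.exp t ≤
      2 * (((n + 1).factorial : ℝ) / δ ^ (n + 1) * Real.exp δ) * Real.exp (δ * Real.sinh t) := by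
    calc Real.cosh t ^ n * Real.exp t ≤ Real.cosh t ^ n * (2 * Real.cosh t) := by gcongr
      _ = 2 * ((δ * Real.cosh t) ^ (n + 1) / δ ^ (n + 1)) := by
        rw [mul_pow, mul_div_cancel_left₀ _ (by positivity)]; ring
      _ ≤ 2 * ((n + 1).factorial * (Real.exp δ * Real.exp (δ * Real.sinh t)) / δ ^ (n + 1)) := by
        gcongr
      _ = _ := by ring
  rw [Real.exp_neg, Real.exp_neg, ← div_eq_mul_inv, ← div_eq_mul_inv,
    div_le_div_iff₀ (Real.exp_pos _) (Real.exp_pos _)]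
  exact h5

lemma integrableOn_exp_neg : IntegrableOn (fun t : ℝ => Real.exp (-t)) (Ioi 0) :=
  integrableOn_exp_neg_Ioi 0

lemma integrableOn_cosh_pow_mul_exp (n : ℕ) {δ : ℝ} (hδ : 0 < δ) :
    IntegrableOn (fun t => Real.cosh t ^ n * Real.exp (-(δ * Real.sinh t))) (Ioi 0) := by
  obtain ⟨C, hC⟩ := exists_cosh_pow_mul_exp_le n hδ
  have hc := Real.continuous_cosh
  have hs := Real.continuous_sinh
  refine Integrable.mono' (integrableOn_exp_neg.const_mul C)
    (by fun_prop : Continuous fun t => Real.cosh t ^ n *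
      Real.exp (-(δ * Real.sinh t))).aestronglyMeasurable ?_
  filter_upwards [ae_restrict_mem measurableSet_Ioi] with t ht
  rw [Real.norm_of_nonneg (mul_nonneg (pow_nonneg (Real.cosh_pos t).le n) (Real.exp_pos _).le)]
  exact hC t (mem_Ioi.1 ht).le

lemma integrableOn_mul_evanescentWave {w : ℝ → ℂ} (hw : Continuous w) {n : ℕ}
    (hwn : ∀ t, ‖w t‖ ≤ Real.cosh t ^ n) (a : ℝ) {h : ℝ} (hh : 0 < h) :
    IntegrableOn (fun t => w t * evanescentWave a h t) (Ioi 0) := by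
  refine Integrable.mono' (integrableOn_cosh_pow_mul_exp n hh)
    (hw.mul (continuous_evanescentWave a h)).aestronglyMeasurable (ae_of_all _ fun t => ?_)
  rw [norm_mul, norm_evanescentWave]
  gcongr; exact hwn t

lemma integrableOn_evanescentWave (a : ℝ) {h : ℝ} (hh : 0 < h) :
    IntegrableOn (evanescentWave a h) (Ioi 0) := by
  simpa using integrableOn_mul_evanescentWave (w := fun _ => 1) (n := 0) continuous_const
    (by simp) a hh

lemma norm_sinh_le_cosh (t : ℝ) : ‖((Real.sinh t : ℝ) : ℂ)‖ ≤ Real.cosh t ^ 1 := by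
  rw [Complex.norm_real, Real.norm_eq_abs, pow_one, Real.abs_sinh, ← Real.cosh_abs]
  exact (Real.sinh_lt_cosh _).le

/-- Differentiation under the integral sign of a weighted superposition of propagating waves along
a path in the plane. -/
lemma hasDerivAt_integral_propagatingWave {w : ℝ → ℂ} (hw : Continuous w) (hw1 : ∀ θ, ‖w θ‖ ≤ 1)
    {a h a' h' : ℝ → ℝ} (ha : ∀ s, HasDerivAt a (a' s) s) (hh : ∀ s, HasDerivAt h (h' s) s)
    {M : ℝ} (ha' : ∀ s, |a' s| ≤ M) (hh' : ∀ s, |h' s| ≤ M) (α β s₀ : ℝ) :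
    HasDerivAt (fun s => ∫ θ in α..β, w θ * propagatingWave (a s) (h s) θ)
      (∫ θ in α..β, w θ * (Complex.I * ((a' s₀ * Real.sin θ + h' s₀ * Real.cos θ : ℝ) : ℂ) *
        propagatingWave (a s₀) (h s₀) θ)) s₀ := by
  refine (intervalIntegral.hasDerivAt_integral_of_dominated_loc_of_deriv_le
    (bound := fun _ => 2 * M) (s := univ)
    (F := fun s θ => w θ * propagatingWave (a s) (h s) θ)
    (F' := fun s θ => w θ * (Complex.I * ((a' s * Real.sin θ + h' s * Real.cos θ : ℝ) : ℂ) *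
        propagatingWave (a s) (h s) θ)) univ_mem
    (Eventually.of_forall fun s => ?_) ?_ ?_ ?_ ?_ ?_).2
  · exact (by fun_prop : Continuous _).aestronglyMeasurable
  · exact (by fun_prop : Continuous _).intervalIntegrable _ _
  · exact (by fun_prop : Continuous _).aestronglyMeasurable
  · refine ae_of_all _ fun θ _ s _ => ?_
    rw [norm_mul, norm_mul, norm_mul, norm_propagatingWave, Complex.norm_I, Complex.norm_real,
      one_mul, mul_one, Real.norm_eq_abs]
    have h1 : |a' s * Real.sin θ + h' s * Real.cos θ| ≤ 2 * M := by
      refine (abs_add_le _ _).trans ?_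
      rw [abs_mul, abs_mul]
      nlinarith [ha' s, hh' s, Real.abs_sin_le_one θ, Real.abs_cos_le_one θ, abs_nonneg (a' s),
        abs_nonneg (h' s), abs_nonneg (Real.sin θ), abs_nonneg (Real.cos θ)]
    calc _ ≤ 1 * |a' s * Real.sin θ + h' s * Real.cos θ| := by gcongr; exact hw1 θ
      _ ≤ _ := by rw [one_mul]; exact h1
  · exact intervalIntegrable_const
  · refine ae_of_all _ fun θ _ s _ => HasDerivAt.const_mul _ ?_
    have := ((((ha s).mul_const (Real.sin θ)).add
      ((hh s).mul_const (Real.cos θ))).ofReal_comp.const_mul Complex.I).cexp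
    refine this.congr_deriv ?_
    simp only [propagatingWave, Pi.add_apply]
    ring

/-- Differentiation under the integral sign of a weighted superposition of evanescent waves along
a path in the plane. -/
lemma hasDerivAt_integral_evanescentWave {w : ℝ → ℂ} (hw : Continuous w) {n : ℕ}
    (hwn : ∀ t, ‖w t‖ ≤ Real.cosh t ^ n)
    {a h a' h' : ℝ → ℝ} (ha : ∀ s, HasDerivAt a (a' s) s) (hh : ∀ s, HasDerivAt h (h' s) s)
    {M : ℝ} (ha' : ∀ s, |a' s| ≤ M) (hh' : ∀ s, |h' s| ≤ M) {s₀ : ℝ} (hs₀ : 0 < h s₀) :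
    HasDerivAt (fun s => ∫ t in Ioi 0, w t * evanescentWave (a s) (h s) t)
      (∫ t in Ioi 0, w t * ((Complex.I * ((a' s₀ * Real.cosh t : ℝ) : ℂ) -
        ((h' s₀ * Real.sinh t : ℝ) : ℂ)) * evanescentWave (a s₀) (h s₀) t)) s₀ := by
  have hc := Real.continuous_cosh
  have hsi := Real.continuous_sinh
  have hδ : 0 < h s₀ / 2 := by positivity
  have hnhds : {s | h s₀ / 2 < h s} ∈ 𝓝 s₀ :=
    (hh s₀).continuousAt.eventually (lt_mem_nhds (by linarith))
  refine (hasDerivAt_integral_of_dominated_loc_of_deriv_le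
    (bound := fun t => 2 * M * (Real.cosh t ^ (n + 1) *
      Real.exp (-(h s₀ / 2 * Real.sinh t)))) (s := {s | h s₀ / 2 < h s})
    (F := fun s t => w t * evanescentWave (a s) (h s) t)
    (F' := fun s t => w t * ((Complex.I * ((a' s * Real.cosh t : ℝ) : ℂ) -
        ((h' s * Real.sinh t : ℝ) : ℂ)) * evanescentWave (a s) (h s) t)) hnhds
    (Eventually.of_forall fun s => ?_) ?_ ?_ ?_ ?_ ?_).2
  · exact (by fun_prop : Continuous _).aestronglyMeasurable
  · exact integrableOn_mul_evanescentWave hw hwn _ hs₀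
  · exact (by fun_prop : Continuous _).aestronglyMeasurable
  · filter_upwards [ae_restrict_mem measurableSet_Ioi] with t (ht : 0 < t) s hs
    have hst : 0 ≤ Real.sinh t := Real.sinh_nonneg_iff.2 ht.le
    have hct : 0 < Real.cosh t := Real.cosh_pos t
    have hM : 0 ≤ M := (abs_nonneg _).trans (ha' s)
    rw [norm_mul, norm_mul, norm_evanescentWave]
    have h1 : ‖Complex.I * ((a' s * Real.cosh t : ℝ) : ℂ) - ((h' s * Real.sinh t : ℝ) : ℂ)‖ ≤
        2 * M * Real.cosh t := by
      refine (norm_sub_le _ _).trans ?_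
      rw [norm_mul, Complex.norm_I, Complex.norm_real, Complex.norm_real, Real.norm_eq_abs,
        Real.norm_eq_abs, abs_mul, abs_mul, abs_of_pos hct, abs_of_nonneg hst, one_mul]
      have := (Real.sinh_lt_cosh t).le
      have e1 := mul_le_mul_of_nonneg_right (ha' s) hct.le
      have e2 := mul_le_mul (hh' s) this hst hM
      linarith
    have h2 : Real.exp (-(h s * Real.sinh t)) ≤ Real.exp (-(h s₀ / 2 * Real.sinh t)) := by
      refine Real.exp_le_exp.2 (neg_le_neg ?_)
      gcongr
    calc _ ≤ Real.cosh t ^ n * (2 * M * Real.cosh t * Real.exp (-(h s₀ / 2 * Real.sinh t))) := by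
          gcongr; exact hwn t
      _ = _ := by ring
  · exact (integrableOn_cosh_pow_mul_exp (n + 1) hδ).const_mul _
  · refine ae_of_all _ fun t s _ => HasDerivAt.const_mul _ ?_
    have := ((((ha s).mul_const (Real.cosh t)).ofReal_comp.const_mul Complex.I).sub
      ((hh s).mul_const (Real.sinh t)).ofReal_comp).cexp
    refine this.congr_deriv ?_
    simp only [evanescentWave, Pi.sub_apply]
    ring

/-- The superposition `∫ e^{i (a sin θ + h cos θ)} dθ` of the propagating waves in all upward
directions. -/
noncomputable def propagatingPart (a h : ℝ) : ℂ :=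
  ∫ θ in (-(Real.pi / 2))..(Real.pi / 2), propagatingWave a h θ

/-- The superposition `∫₀^∞ e^{i a cosh t - h sinh t} dt` of evanescent waves. -/
noncomputable def evanescentPart (a h : ℝ) : ℂ :=
  ∫ t in Ioi 0, evanescentWave a h t

/-- `π` times the plane wave expansion of the outgoing fundamental solution in the half-plane
`h > 0`. -/
noncomputable def planeWaveSum (a h : ℝ) : ℂ :=
  propagatingPart a h - Complex.I * (evanescentPart a h + evanescentPart (-a) h)

/-- The `h`-derivative of `planeWaveSum a h`. -/
noncomputable def planeWaveSumDeriv (a h : ℝ) : ℂ :=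
  (∫ θ in (-(Real.pi / 2))..(Real.pi / 2),
    Complex.I * (Real.cos θ : ℂ) * propagatingWave a h θ) +
  Complex.I * ((∫ t in Ioi 0, (Real.sinh t : ℂ) * evanescentWave a h t) +
    ∫ t in Ioi 0, (Real.sinh t : ℂ) * evanescentWave (-a) h t)

lemma hasDerivAt_propagatingPart {a h a' h' : ℝ → ℝ} (ha : ∀ s, HasDerivAt a (a' s) s)
    (hh : ∀ s, HasDerivAt h (h' s) s) {M : ℝ} (ha' : ∀ s, |a' s| ≤ M) (hh' : ∀ s, |h' s| ≤ M)
    (s₀ : ℝ) :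
    HasDerivAt (fun s => propagatingPart (a s) (h s))
      (∫ θ in (-(Real.pi / 2))..(Real.pi / 2),
        Complex.I * ((a' s₀ * Real.sin θ + h' s₀ * Real.cos θ : ℝ) : ℂ) *
        propagatingWave (a s₀) (h s₀) θ) s₀ := by
  simpa [propagatingPart] using hasDerivAt_integral_propagatingWave (w := fun _ => 1)
    continuous_const (by simp) ha hh ha' hh' (-(Real.pi / 2)) (Real.pi / 2) s₀

lemma hasDerivAt_evanescentPart {a h a' h' : ℝ → ℝ} (ha : ∀ s, HasDerivAt a (a' s) s)
    (hh : ∀ s, HasDerivAt h (h' s) s) {M : ℝ} (ha' : ∀ s, |a' s| ≤ M) (hh' : ∀ s, |h' s| ≤ M)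
    {s₀ : ℝ} (hs₀ : 0 < h s₀) :
    HasDerivAt (fun s => evanescentPart (a s) (h s))
      (∫ t in Ioi 0, (Complex.I * ((a' s₀ * Real.cosh t : ℝ) : ℂ) -
        ((h' s₀ * Real.sinh t : ℝ) : ℂ)) * evanescentWave (a s₀) (h s₀) t) s₀ := by
  simpa [evanescentPart] using hasDerivAt_integral_evanescentWave (w := fun _ => 1) (n := 0)
    continuous_const (by simp) ha hh ha' hh' hs₀

lemma hasDerivAt_planeWaveSum (a : ℝ) {h : ℝ} (hh : 0 < h) :
    HasDerivAt (planeWaveSum a) (planeWaveSumDeriv a h) h := by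
  have k1 : ∀ s : ℝ, |(0 : ℝ)| ≤ 1 := by simp
  have k2 : ∀ s : ℝ, |(1 : ℝ)| ≤ 1 := by simp
  have h1 := hasDerivAt_propagatingPart (fun s => hasDerivAt_const s a) hasDerivAt_id k1 k2 h
  have h2 := hasDerivAt_evanescentPart (fun s => hasDerivAt_const s a) hasDerivAt_id k1 k2
    (s₀ := h) hh
  have h3 := hasDerivAt_evanescentPart (fun s => hasDerivAt_const s (-a)) hasDerivAt_id k1 k2
    (s₀ := h) hh
  refine (h1.sub ((h2.add h3).const_mul Complex.I)).congr_deriv ?_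
  simp only [zero_mul, one_mul, zero_add, id, Complex.ofReal_zero, mul_zero, zero_sub, neg_mul,
    integral_neg, planeWaveSumDeriv]
  ring

/-! ### Rotational invariance of the plane wave sum -/

lemma tendsto_sinh_atTop : Tendsto Real.sinh atTop atTop :=
  Real.sinhOrderIso.tendsto_atTop

lemma tendsto_mul_evanescentWave {w : ℝ → ℂ} {n : ℕ} (hwn : ∀ t, ‖w t‖ ≤ Real.cosh t ^ n)
    (a : ℝ) {h : ℝ} (hh : 0 < h) :
    Tendsto (fun t => w t * evanescentWave a h t) atTop (𝓝 0) := by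
  obtain ⟨C, hC⟩ := exists_cosh_pow_mul_exp_le n hh
  refine squeeze_zero_norm' (a := fun t => C * Real.exp (-t)) ?_ ?_
  · filter_upwards [eventually_ge_atTop 0] with t ht
    rw [norm_mul, norm_evanescentWave]
    exact (mul_le_mul_of_nonneg_right (hwn t) (Real.exp_pos _).le).trans (hC t ht)
  · simpa using (Real.tendsto_exp_neg_atTop_nhds_zero).const_mul C

lemma tendsto_evanescentWave (a : ℝ) {h : ℝ} (hh : 0 < h) :
    Tendsto (evanescentWave a h) atTop (𝓝 0) := by
  simpa using tendsto_mul_evanescentWave (w := fun _ => 1) (n := 0) (by simp) a hh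

lemma hasDerivAt_evanescentWave (a h t : ℝ) : HasDerivAt (evanescentWave a h)
    ((Complex.I * ((a * Real.sinh t : ℝ) : ℂ) - ((h * Real.cosh t : ℝ) : ℂ)) *
      evanescentWave a h t) t := by
  have := ((((Real.hasDerivAt_cosh t).const_mul a).ofReal_comp.const_mul Complex.I).sub
      ((Real.hasDerivAt_sinh t).const_mul h).ofReal_comp).cexp
  refine this.congr_deriv ?_
  simp only [evanescentWave, Pi.sub_apply]
  ring

lemma hasDerivAt_propagatingWave (a h θ : ℝ) : HasDerivAt (propagatingWave a h)
    (Complex.I * ((a * Real.cos θ - h * Real.sin θ : ℝ) : ℂ) * propagatingWave a h θ) θ := by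
  have := (((((Real.hasDerivAt_sin θ).const_mul a).add
      ((Real.hasDerivAt_cos θ).const_mul h)).ofReal_comp).const_mul Complex.I).cexp
  refine this.congr_deriv ?_
  simp only [propagatingWave, Pi.add_apply]
  push_cast
  ring

lemma integral_deriv_propagatingWave (a h : ℝ) :
    ∫ θ in (-(Real.pi / 2))..(Real.pi / 2),
      Complex.I * ((a * Real.cos θ - h * Real.sin θ : ℝ) : ℂ) * propagatingWave a h θ =
    Complex.exp (Complex.I * a) - Complex.exp (-(Complex.I * a)) := by
  rw [intervalIntegral.integral_eq_sub_of_hasDerivAt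
    (fun θ _ => hasDerivAt_propagatingWave a h θ)
    ((by fun_prop : Continuous _).intervalIntegrable _ _)]
  simp [propagatingWave]

lemma integrableOn_deriv_evanescentWave (a b : ℝ) (c : ℝ) {h : ℝ} (hh : 0 < h) :
    IntegrableOn (fun t => (Complex.I * ((a * Real.sinh t : ℝ) : ℂ) -
      ((b * Real.cosh t : ℝ) : ℂ)) * evanescentWave c h t) (Ioi 0) := by
  have hsi : Continuous fun t => ((Real.sinh t : ℝ) : ℂ) := by
    have := Real.continuous_sinh; fun_prop
  have hco : Continuous fun t => ((Real.cosh t : ℝ) : ℂ) := by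
    have := Real.continuous_cosh; fun_prop
  have h1 := integrableOn_mul_evanescentWave hsi norm_sinh_le_cosh c hh
  have h2 := integrableOn_mul_evanescentWave hco (n := 1) (fun t => by
    rw [Complex.norm_real, Real.norm_eq_abs, abs_of_pos (Real.cosh_pos t), pow_one]) c hh
  refine ((h1.const_mul (Complex.I * a)).sub (h2.const_mul (b : ℂ))).congr (ae_of_all _ fun t => ?_)
  simp only [Pi.sub_apply]; push_cast; ring

lemma integral_deriv_evanescentWave (a : ℝ) {h : ℝ} (hh : 0 < h) :
    ∫ t in Ioi 0, (Complex.I * ((a * Real.sinh t : ℝ) : ℂ) - ((h * Real.cosh t : ℝ) : ℂ)) *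
      evanescentWave a h t = -Complex.exp (Complex.I * a) := by
  rw [integral_Ioi_of_hasDerivAt_of_tendsto' (fun t _ => hasDerivAt_evanescentWave a h t)
    (integrableOn_deriv_evanescentWave a h a hh) (tendsto_evanescentWave a hh)]
  simp [evanescentWave]

/-- Along a circle, the derivative of each wave with respect to the polar angle is, up to a constant
factor, its derivative with respect to the wave parameter; the boundary terms of the propagating and
the evanescent part cancel. -/
lemma hasDerivAt_planeWaveSum_rotate (r : ℝ) {φ : ℝ} (hr : 0 < r * Real.cos φ) :
    HasDerivAt (fun φ => planeWaveSum (r * Real.sin φ) (r * Real.cos φ)) 0 φ := by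
  have ha : ∀ s, HasDerivAt (fun φ => r * Real.sin φ) (r * Real.cos s) s := fun s =>
    (Real.hasDerivAt_sin s).const_mul r
  have ha2 : ∀ s, HasDerivAt (fun φ => -(r * Real.sin φ)) (-(r * Real.cos s)) s := fun s =>
    (ha s).neg
  have hh : ∀ s, HasDerivAt (fun φ => r * Real.cos φ) (-(r * Real.sin s)) s := fun s =>
    ((Real.hasDerivAt_cos s).const_mul r).congr_deriv (by ring)
  have ha' : ∀ s, |r * Real.cos s| ≤ |r| := fun s => by
    rw [abs_mul]; exact mul_le_of_le_one_right (abs_nonneg r) (Real.abs_cos_le_one s)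
  have ha2' : ∀ s, |-(r * Real.cos s)| ≤ |r| := fun s => by rw [abs_neg]; exact ha' s
  have hh' : ∀ s, |-(r * Real.sin s)| ≤ |r| := fun s => by
    rw [abs_neg, abs_mul]; exact mul_le_of_le_one_right (abs_nonneg r) (Real.abs_sin_le_one s)
  have h1 := hasDerivAt_propagatingPart ha hh ha' hh' φ
  have h2 := hasDerivAt_evanescentPart ha hh ha' hh' (s₀ := φ) hr
  have h3 := hasDerivAt_evanescentPart ha2 hh ha2' hh' (s₀ := φ) hr
  refine (h1.sub ((h2.add h3).const_mul Complex.I)).congr_deriv ?_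
  have i1 := integral_deriv_propagatingWave (r * Real.sin φ) (r * Real.cos φ)
  have i2 := integral_deriv_evanescentWave (r * Real.sin φ) hr
  have i3 := integral_deriv_evanescentWave (-(r * Real.sin φ)) hr
  have j1 : ∫ θ in (-(Real.pi / 2))..(Real.pi / 2),
        Complex.I * ((r * Real.cos φ * Real.sin θ + -(r * Real.sin φ) * Real.cos θ : ℝ) : ℂ) *
        propagatingWave (r * Real.sin φ) (r * Real.cos φ) θ =
      -(∫ θ in (-(Real.pi / 2))..(Real.pi / 2),
        Complex.I * ((r * Real.sin φ * Real.cos θ - r * Real.cos φ * Real.sin θ : ℝ) : ℂ) *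
        propagatingWave (r * Real.sin φ) (r * Real.cos φ) θ) := by
    rw [← intervalIntegral.integral_neg]
    congr 1; funext θ; push_cast; ring
  have j2 : ∫ t in Ioi 0, (Complex.I * ((r * Real.cos φ * Real.cosh t : ℝ) : ℂ) -
        ((-(r * Real.sin φ) * Real.sinh t : ℝ) : ℂ)) *
        evanescentWave (r * Real.sin φ) (r * Real.cos φ) t =
      -Complex.I * ∫ t in Ioi 0, (Complex.I * ((r * Real.sin φ * Real.sinh t : ℝ) : ℂ) -
        ((r * Real.cos φ * Real.cosh t : ℝ) : ℂ)) *
        evanescentWave (r * Real.sin φ) (r * Real.cos φ) t := by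
    rw [← integral_const_mul]
    congr 1; funext t; push_cast; linear_combination (r * Complex.sin φ * Complex.sinh t *
      evanescentWave (r * Real.sin φ) (r * Real.cos φ) t : ℂ) * Complex.I_sq
  have j3 : ∫ t in Ioi 0, (Complex.I * ((-(r * Real.cos φ) * Real.cosh t : ℝ) : ℂ) -
        ((-(r * Real.sin φ) * Real.sinh t : ℝ) : ℂ)) *
        evanescentWave (-(r * Real.sin φ)) (r * Real.cos φ) t =
      Complex.I * ∫ t in Ioi 0, (Complex.I * ((-(r * Real.sin φ) * Real.sinh t : ℝ) : ℂ) -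
        ((r * Real.cos φ * Real.cosh t : ℝ) : ℂ)) *
        evanescentWave (-(r * Real.sin φ)) (r * Real.cos φ) t := by
    rw [← integral_const_mul]
    congr 1; funext t; push_cast; linear_combination (r * Complex.sin φ * Complex.sinh t *
      evanescentWave (-(r * Real.sin φ)) (r * Real.cos φ) t : ℂ) * Complex.I_sq
  rw [j1, j2, j3, i1, i2, i3]
  push_cast
  simp only [mul_neg]
  linear_combination (Complex.exp (-(Complex.I * (r * Complex.sin φ))) -
    Complex.exp (Complex.I * (r * Complex.sin φ))) * Complex.I_sq

/-- The plane wave sum depends only on the distance to the origin. -/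
lemma planeWaveSum_eq_radial (a : ℝ) {h : ℝ} (hh : 0 < h) :
    planeWaveSum a h = planeWaveSum 0 (√(a ^ 2 + h ^ 2)) := by
  set r := √(a ^ 2 + h ^ 2)
  have hr2 : r ^ 2 = a ^ 2 + h ^ 2 := Real.sq_sqrt (by positivity)
  have hr : 0 < r := Real.sqrt_pos.2 (by positivity)
  -- Rotate the point `(a, h)` to the vertical axis along the circle of radius `r`.
  set φ := Real.arcsin (a / r)
  have hlt : |a / r| < 1 := by
    rw [abs_div, abs_of_pos hr, div_lt_one hr]
    exact abs_lt_of_sq_lt_sq (by nlinarith) hr.le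
  have hφ : φ ∈ Ioo (-(Real.pi / 2)) (Real.pi / 2) :=
    ⟨Real.neg_pi_div_two_lt_arcsin.2 (abs_lt.1 hlt).1,
      Real.arcsin_lt_pi_div_two.2 (abs_lt.1 hlt).2⟩
  have h0 : (0 : ℝ) ∈ Ioo (-(Real.pi / 2)) (Real.pi / 2) :=
    ⟨by linarith [Real.pi_pos], by linarith [Real.pi_pos]⟩
  have hsin : r * Real.sin φ = a := by
    rw [Real.sin_arcsin (abs_lt.1 hlt).1.le (abs_lt.1 hlt).2.le]; field_simp
  have hcos : r * Real.cos φ = h := by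
    rw [Real.cos_arcsin, show (1 : ℝ) - (a / r) ^ 2 = (h / r) ^ 2 by
      field_simp; linarith, Real.sqrt_sq (by positivity)]
    field_simp
  have key := (convex_Ioo (-(Real.pi / 2)) (Real.pi / 2)).is_const_of_fderivWithin_eq_zero
    (𝕜 := ℝ) (f := fun φ => planeWaveSum (r * Real.sin φ) (r * Real.cos φ))
    (fun x hx => (hasDerivAt_planeWaveSum_rotate r
      (mul_pos hr (Real.cos_pos_of_mem_Ioo hx))).differentiableAt.differentiableWithinAt)
    (fun x hx => by
      have hd := hasDerivAt_planeWaveSum_rotate r (mul_pos hr (Real.cos_pos_of_mem_Ioo hx))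
      rw [fderivWithin_eq_fderiv (isOpen_Ioo.uniqueDiffWithinAt hx) hd.differentiableAt]
      ext; simp [hd.deriv]) hφ h0
  simpa [hsin, hcos] using key

/-! ### The plane wave sum on the vertical axis -/

lemma planeWaveSum_zero_left (h : ℝ) :
    planeWaveSum 0 h = propagatingPart 0 h - 2 * Complex.I * evanescentPart 0 h := by
  rw [planeWaveSum, neg_zero]; ring

lemma planeWaveSumDeriv_zero_left (h : ℝ) :
    planeWaveSumDeriv 0 h = (∫ θ in (-(Real.pi / 2))..(Real.pi / 2),
      Complex.I * (Real.cos θ : ℂ) * propagatingWave 0 h θ) +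
      2 * Complex.I * ∫ t in Ioi 0, (Real.sinh t : ℂ) * evanescentWave 0 h t := by
  rw [planeWaveSumDeriv, neg_zero]; ring

@[fun_prop]
lemma continuous_ofReal_sinh : Continuous fun t => ((Real.sinh t : ℝ) : ℂ) :=
  Complex.continuous_ofReal.comp Real.continuous_sinh

@[fun_prop]
lemma continuous_ofReal_cosh : Continuous fun t => ((Real.cosh t : ℝ) : ℂ) :=
  Complex.continuous_ofReal.comp Real.continuous_cosh

lemma norm_cosh_le_cosh (t : ℝ) : ‖((Real.cosh t : ℝ) : ℂ)‖ ≤ Real.cosh t ^ 1 := by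
  rw [Complex.norm_real, Real.norm_eq_abs, abs_of_pos (Real.cosh_pos t), pow_one]

/-- Integration by parts for the second derivative of the propagating part. -/
lemma integral_cos_mul_propagatingWave (r : ℝ) :
    (∫ θ in (-(Real.pi / 2))..(Real.pi / 2), (Real.cos θ : ℂ) * propagatingWave 0 r θ) -
      Complex.I * r * ∫ θ in (-(Real.pi / 2))..(Real.pi / 2),
        (Real.sin θ : ℂ) ^ 2 * propagatingWave 0 r θ = 2 := by
  have hd : ∀ θ : ℝ, HasDerivAt (fun θ : ℝ => (Real.sin θ : ℂ) * propagatingWave 0 r θ)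
      ((Real.cos θ : ℂ) * propagatingWave 0 r θ -
        Complex.I * r * ((Real.sin θ : ℂ) ^ 2 * propagatingWave 0 r θ)) θ := fun θ => by
    refine ((Real.hasDerivAt_sin θ).ofReal_comp.mul
      (hasDerivAt_propagatingWave 0 r θ)).congr_deriv ?_
    push_cast; ring
  rw [← intervalIntegral.integral_const_mul, ← intervalIntegral.integral_sub
    ((by fun_prop : Continuous _).intervalIntegrable _ _)
    ((by fun_prop : Continuous _).intervalIntegrable _ _),
    intervalIntegral.integral_eq_sub_of_hasDerivAt (fun θ _ => hd θ)
    ((by fun_prop : Continuous _).intervalIntegrable _ _)]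
  simp [propagatingWave]
  norm_num

lemma integrableOn_sinh_mul_evanescentWave (a : ℝ) {h : ℝ} (hh : 0 < h) :
    IntegrableOn (fun t => (Real.sinh t : ℂ) * evanescentWave a h t) (Ioi 0) :=
  integrableOn_mul_evanescentWave continuous_ofReal_sinh norm_sinh_le_cosh a hh

lemma integrableOn_cosh_mul_evanescentWave (a : ℝ) {h : ℝ} (hh : 0 < h) :
    IntegrableOn (fun t => (Real.cosh t : ℂ) * evanescentWave a h t) (Ioi 0) :=
  integrableOn_mul_evanescentWave continuous_ofReal_cosh norm_cosh_le_cosh a hh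

lemma integrableOn_cosh_sq_mul_evanescentWave (a : ℝ) {h : ℝ} (hh : 0 < h) :
    IntegrableOn (fun t => (Real.cosh t : ℂ) ^ 2 * evanescentWave a h t) (Ioi 0) :=
  integrableOn_mul_evanescentWave (by fun_prop) (n := 2) (fun t => by
    rw [norm_pow]; simpa using pow_le_pow_left₀ (norm_nonneg _) (norm_cosh_le_cosh t) 2) a hh

/-- Integration by parts for the second derivative of the evanescent part. Its boundary term cancels
the one of `integral_cos_mul_propagatingWave` in `solvesBessel_planeWaveSum`. -/
lemma integral_sinh_mul_evanescentWave {r : ℝ} (hr : 0 < r) :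
    (∫ t in Ioi 0, (Real.sinh t : ℂ) * evanescentWave 0 r t) -
      r * ∫ t in Ioi 0, (Real.cosh t : ℂ) ^ 2 * evanescentWave 0 r t = -1 := by
  have hd : ∀ t : ℝ, HasDerivAt (fun t : ℝ => (Real.cosh t : ℂ) * evanescentWave 0 r t)
      ((Real.sinh t : ℂ) * evanescentWave 0 r t -
        r * ((Real.cosh t : ℂ) ^ 2 * evanescentWave 0 r t)) t := fun t => by
    refine ((Real.hasDerivAt_cosh t).ofReal_comp.mul
      (hasDerivAt_evanescentWave 0 r t)).congr_deriv ?_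
    push_cast; ring
  have h1 := integrableOn_sinh_mul_evanescentWave 0 hr
  have h2 := (integrableOn_cosh_sq_mul_evanescentWave 0 hr).const_mul (r : ℂ)
  rw [← integral_const_mul, ← integral_sub h1 h2,
    integral_Ioi_of_hasDerivAt_of_tendsto' (fun t _ => hd t) (h1.sub h2)
    (tendsto_mul_evanescentWave norm_cosh_le_cosh 0 hr)]
  simp [evanescentWave]

lemma integral_cosh_mul_evanescentWave {r : ℝ} (hr : 0 < r) :
    r * ∫ t in Ioi 0, (Real.cosh t : ℂ) * evanescentWave 0 r t = 1 := by
  have h := integral_deriv_evanescentWave 0 hr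
  simp only [zero_mul, Complex.ofReal_zero, mul_zero, zero_sub, Complex.exp_zero, neg_mul,
    integral_neg, neg_inj] at h
  rw [← h, ← integral_const_mul]
  congr 1; funext t; push_cast; ring

lemma solvesBessel_planeWaveSum : SolvesBessel (planeWaveSum 0) (planeWaveSumDeriv 0) := by
  intro r hr
  refine ⟨hasDerivAt_planeWaveSum 0 hr, ?_⟩
  have k1 : ∀ s : ℝ, |(0 : ℝ)| ≤ 1 := by simp
  have k2 : ∀ s : ℝ, |(1 : ℝ)| ≤ 1 := by simp
  have h1 := hasDerivAt_integral_propagatingWave (w := fun θ => Complex.I * (Real.cos θ : ℂ))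
    (by fun_prop) (fun θ => by
      rw [norm_mul, Complex.norm_I, one_mul, Complex.norm_real]; exact Real.abs_cos_le_one θ)
    (fun s => hasDerivAt_const s 0) hasDerivAt_id k1 k2 (-(Real.pi / 2)) (Real.pi / 2) r
  have h2 := hasDerivAt_integral_evanescentWave (w := fun t => (Real.sinh t : ℂ))
    continuous_ofReal_sinh norm_sinh_le_cosh (fun s => hasDerivAt_const s 0) hasDerivAt_id k1 k2
    (s₀ := r) hr
  have hfun : planeWaveSumDeriv 0 = fun h => (∫ θ in (-(Real.pi / 2))..(Real.pi / 2),
      Complex.I * (Real.cos θ : ℂ) * propagatingWave 0 h θ) +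
      2 * Complex.I * ∫ t in Ioi 0, (Real.sinh t : ℂ) * evanescentWave 0 h t :=
    funext planeWaveSumDeriv_zero_left
  rw [hfun]
  refine (h1.add (h2.const_mul (2 * Complex.I))).congr_deriv ?_
  have iP := integral_cos_mul_propagatingWave r
  have iE := integral_sinh_mul_evanescentWave hr
  have e1 : (∫ θ in (-(Real.pi / 2))..(Real.pi / 2), Complex.I * (Real.cos θ : ℂ) *
      (Complex.I * ((0 * Real.sin θ + 1 * Real.cos θ : ℝ) : ℂ) * propagatingWave 0 (id r) θ)) =
      (∫ θ in (-(Real.pi / 2))..(Real.pi / 2), (Real.sin θ : ℂ) ^ 2 * propagatingWave 0 r θ) -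
        propagatingPart 0 r := by
    rw [propagatingPart, ← intervalIntegral.integral_sub
      ((by fun_prop : Continuous _).intervalIntegrable _ _)
      ((by fun_prop : Continuous _).intervalIntegrable _ _)]
    congr 1; funext θ
    push_cast
    rw [id]
    linear_combination (propagatingWave 0 r θ) *
      ((Complex.cos θ) ^ 2 * Complex.I_sq - Complex.sin_sq_add_cos_sq (θ : ℂ))
  have e2 : (∫ t in Ioi 0, (Real.sinh t : ℂ) * ((Complex.I * ((0 * Real.cosh t : ℝ) : ℂ) -
      ((1 * Real.sinh t : ℝ) : ℂ)) * evanescentWave 0 (id r) t)) =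
      evanescentPart 0 r - ∫ t in Ioi 0, (Real.cosh t : ℂ) ^ 2 * evanescentWave 0 r t := by
    rw [evanescentPart, ← integral_sub (integrableOn_evanescentWave 0 hr)
      (integrableOn_cosh_sq_mul_evanescentWave 0 hr)]
    congr 1; funext t
    push_cast
    rw [id]
    linear_combination (evanescentWave 0 r t) * (Complex.cosh_sq (t : ℂ))
  have e3 : (∫ θ in (-(Real.pi / 2))..(Real.pi / 2),
      Complex.I * (Real.cos θ : ℂ) * propagatingWave 0 r θ) =
      Complex.I * ∫ θ in (-(Real.pi / 2))..(Real.pi / 2),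
        (Real.cos θ : ℂ) * propagatingWave 0 r θ := by
    rw [← intervalIntegral.integral_const_mul]
    congr 1; funext θ; ring
  beta_reduce
  rw [e1, e2, planeWaveSum_zero_left, e3]
  have hr' : (r : ℂ) ≠ 0 := by exact_mod_cast hr.ne'
  field_simp
  linear_combination Complex.I * iP + 2 * Complex.I * iE +
    r * (∫ θ in (-(Real.pi / 2))..(Real.pi / 2),
      (Real.sin θ : ℂ) ^ 2 * propagatingWave 0 r θ) * Complex.I_sq

lemma continuous_integral_propagatingWave {w : ℝ → ℂ} (hw : Continuous w) :
    Continuous fun r => ∫ θ in (-(Real.pi / 2))..(Real.pi / 2), w θ * propagatingWave 0 r θ := by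
  refine intervalIntegral.continuous_parametric_intervalIntegral_of_continuous' ?_ _ _
  simp only [Function.uncurry_def, propagatingWave]
  fun_prop

/-- The singular part of the derivative is exact when `sinh` is replaced by `cosh`, and
`cosh t - sinh t = e^{-t}` leaves an integral with a limit. -/
lemma tendsto_planeWaveSumDeriv_sub_inv :
    Tendsto (fun r : ℝ => planeWaveSumDeriv 0 r - 2 * Complex.I * ((1 / r : ℝ) : ℂ))
      (𝓝[>] 0) (𝓝 0) := by
  have h1 := (continuous_integral_propagatingWave
    (w := fun θ => Complex.I * (Real.cos θ : ℂ)) (by fun_prop)).tendsto 0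
  have e1 : (∫ θ in (-(Real.pi / 2))..(Real.pi / 2),
      Complex.I * (Real.cos θ : ℂ) * propagatingWave 0 0 θ) = Complex.I * 2 := by
    have : ∀ θ : ℝ, Complex.I * (Real.cos θ : ℂ) * propagatingWave 0 0 θ =
        Complex.I * ((Real.cos θ : ℝ) : ℂ) := fun θ => by simp [propagatingWave]
    simp only [this]
    rw [intervalIntegral.integral_const_mul, intervalIntegral.integral_ofReal, integral_cos]
    simp; norm_num
  have h2 : Tendsto (fun r : ℝ => ∫ t in Ioi 0, ((Real.exp (-t) : ℝ) : ℂ) * evanescentWave 0 r t)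
      (𝓝[>] 0) (𝓝 (∫ t in Ioi (0 : ℝ), ((Real.exp (-t) : ℝ) : ℂ) * 1)) := by
    refine tendsto_integral_filter_of_dominated_convergence (fun t => Real.exp (-t))
      (Eventually.of_forall fun r =>
        (by fun_prop : Continuous fun t : ℝ => ((Real.exp (-t) : ℝ) : ℂ) *
          evanescentWave 0 r t).aestronglyMeasurable) ?_ integrableOn_exp_neg ?_
    · filter_upwards [self_mem_nhdsWithin] with r (hr : 0 < r)
      filter_upwards [ae_restrict_mem measurableSet_Ioi] with t (ht : 0 < t)
      rw [norm_mul, norm_evanescentWave, Complex.norm_real, Real.norm_of_nonneg (Real.exp_pos _).le]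
      refine mul_le_of_le_one_right (Real.exp_pos _).le (Real.exp_le_one_iff.2 ?_)
      have := mul_nonneg hr.le (Real.sinh_nonneg_iff.2 ht.le)
      linarith
    · refine ae_of_all _ fun t => Tendsto.const_mul _ ?_
      have : Continuous fun r : ℝ => evanescentWave 0 r t := by
        unfold evanescentWave; fun_prop
      have h := (this.tendsto 0).mono_left (nhdsWithin_le_nhds (s := Ioi 0))
      simpa [evanescentWave] using h
  have e2 : ∫ t in Ioi (0 : ℝ), ((Real.exp (-t) : ℝ) : ℂ) * 1 = 1 := by
    simp only [mul_one]
    rw [integral_complex_ofReal, integral_exp_neg_Ioi_zero, Complex.ofReal_one]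
  rw [e1] at h1
  rw [e2] at h2
  have h := (h1.mono_left (nhdsWithin_le_nhds (s := Ioi 0))).sub (h2.const_mul (2 * Complex.I))
  rw [show Complex.I * 2 - 2 * Complex.I * 1 = 0 by ring] at h
  refine h.congr' ?_
  filter_upwards [self_mem_nhdsWithin] with r (hr : 0 < r)
  have hr' : (r : ℂ) ≠ 0 := by exact_mod_cast hr.ne'
  have e3 : (∫ t in Ioi 0, ((Real.exp (-t) : ℝ) : ℂ) * evanescentWave 0 r t) =
      ((1 / r : ℝ) : ℂ) - ∫ t in Ioi 0, (Real.sinh t : ℂ) * evanescentWave 0 r t := by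
    have : ((1 / r : ℝ) : ℂ) = ∫ t in Ioi 0, (Real.cosh t : ℂ) * evanescentWave 0 r t := by
      have := integral_cosh_mul_evanescentWave hr
      push_cast at this ⊢
      field_simp
      exact this.symm
    rw [this, ← integral_sub (integrableOn_cosh_mul_evanescentWave 0 hr)
      (integrableOn_sinh_mul_evanescentWave 0 hr)]
    congr 1; funext t
    rw [← Real.cosh_sub_sinh]; push_cast; ring
  rw [e3, planeWaveSumDeriv_zero_left]
  ring

/-! ### The logarithmic singularity and Euler's constant -/

/-- A majorant of the logarithm that is integrable against `e^{-u}`. -/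
lemma abs_log_le {u : ℝ} (hu : 0 < u) : |Real.log u| ≤ 2 * u ^ (-(1 / 2) : ℝ) + u := by
  rcases le_total u 1 with h | h
  · have h1 := (Real.abs_log_mul_self_rpow_lt u (1 / 2) hu h (by norm_num)).le
    have hp : 0 < u ^ (1 / 2 : ℝ) := Real.rpow_pos_of_pos hu _
    rw [abs_mul, abs_of_pos hp] at h1
    rw [Real.rpow_neg hu.le]
    have : |Real.log u| ≤ 2 * (u ^ (1 / 2 : ℝ))⁻¹ := by
      rw [← div_eq_mul_inv, le_div_iff₀ hp]; linarith
    linarith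
  · rw [abs_of_nonneg (Real.log_nonneg h)]
    have := Real.log_le_sub_one_of_pos hu
    have := Real.rpow_nonneg hu.le (-(1 / 2) : ℝ)
    linarith

lemma integrableOn_exp_neg_mul_bound :
    IntegrableOn (fun u : ℝ => Real.exp (-u) * (2 * u ^ (-(1 / 2) : ℝ) + 3 * u)) (Ioi 0) := by
  have h1 := (Real.GammaIntegral_convergent (s := 1 / 2) (by norm_num)).const_mul 2
  have h2 := (Real.GammaIntegral_convergent (s := 2) (by norm_num)).const_mul 3
  refine (h1.add h2).congr (ae_of_all _ fun u => ?_)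
  simp only [Pi.add_apply]
  norm_num
  ring

lemma integrableOn_exp_neg_mul_log :
    IntegrableOn (fun u : ℝ => Real.exp (-u) * Real.log u) (Ioi 0) := by
  refine Integrable.mono' integrableOn_exp_neg_mul_bound
    (Measurable.aestronglyMeasurable (by fun_prop)) ?_
  filter_upwards [ae_restrict_mem measurableSet_Ioi] with u (hu : 0 < u)
  rw [norm_mul, Real.norm_of_nonneg (Real.exp_pos _).le, Real.norm_eq_abs]
  gcongr
  linarith [abs_log_le hu]

lemma integral_exp_neg_mul_log :
    ∫ u in Ioi (0 : ℝ), Real.exp (-u) * Real.log u = -Real.eulerMascheroniConstant := by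
  have h1 := Complex.hasDerivAt_GammaIntegral (s := 1) (by simp)
  have h2 : Complex.GammaIntegral =ᶠ[𝓝 1] Complex.Gamma := by
    have : {s : ℂ | 0 < s.re} ∈ 𝓝 (1 : ℂ) :=
      (isOpen_lt continuous_const Complex.continuous_re).mem_nhds (by simp)
    filter_upwards [this] with s hs
    exact (Complex.Gamma_eq_integral hs).symm
  have h3 := (h1.congr_of_eventuallyEq h2.symm).unique Complex.hasDerivAt_Gamma_one
  have h4 : (∫ t : ℝ in Ioi 0, (t : ℂ) ^ ((1 : ℂ) - 1) * (Real.log t * Real.exp (-t))) =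
      ((∫ u in Ioi (0 : ℝ), Real.exp (-u) * Real.log u : ℝ) : ℂ) := by
    rw [← integral_complex_ofReal]
    congr 1; funext t; simp [mul_comm]
  rw [h4] at h3
  exact_mod_cast h3

lemma arsinh_le_self {x : ℝ} (hx : 0 ≤ x) : Real.arsinh x ≤ x := by
  have h := Real.self_le_sinh_iff.2 (Real.arsinh_nonneg_iff.2 hx)
  rwa [Real.sinh_arsinh] at h

lemma integrableOn_exp_neg_mul_arsinh {r : ℝ} (hr : 0 < r) :
    IntegrableOn (fun u : ℝ => Real.exp (-u) * Real.arsinh (u / r)) (Ioi 0) := by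
  have h2 := (Real.GammaIntegral_convergent (s := 2) (by norm_num)).const_mul (1 / r)
  have hc := Real.continuous_arsinh
  refine Integrable.mono' h2 (by fun_prop : Continuous fun u : ℝ =>
    Real.exp (-u) * Real.arsinh (u / r)).aestronglyMeasurable ?_
  filter_upwards [ae_restrict_mem measurableSet_Ioi] with u (hu : 0 < u)
  have hur : 0 ≤ u / r := by positivity
  rw [Real.norm_of_nonneg (mul_nonneg (Real.exp_pos _).le (Real.arsinh_nonneg_iff.2 hur))]
  calc _ ≤ Real.exp (-u) * (u / r) := by gcongr; exact arsinh_le_self hur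
    _ = _ := by norm_num; ring

/-- Integration by parts, followed by the substitution `u = r sinh t`. -/
lemma integral_exp_neg_mul_sinh {r : ℝ} (hr : 0 < r) :
    ∫ t in Ioi 0, Real.exp (-(r * Real.sinh t)) =
      ∫ u in Ioi 0, Real.exp (-u) * Real.arsinh (u / r) := by
  have hsi := Real.continuous_sinh
  have hco := Real.continuous_cosh
  have hid : Tendsto (fun t => t * Real.exp (-(r * Real.sinh t))) atTop (𝓝 0) := by
    obtain ⟨C, hC⟩ := exists_cosh_pow_mul_exp_le 1 hr
    refine squeeze_zero_norm' (a := fun t => C * Real.exp (-t)) ?_ ?_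
    · filter_upwards [eventually_ge_atTop 0] with t ht
      rw [Real.norm_of_nonneg (by positivity)]
      refine le_trans ?_ (hC t ht)
      gcongr
      rw [pow_one]
      exact (Real.self_le_sinh_iff.2 ht).trans (Real.sinh_lt_cosh t).le
    · simpa using (Real.tendsto_exp_neg_atTop_nhds_zero).const_mul C
  have i1 : IntegrableOn (fun t => Real.exp (-(r * Real.sinh t))) (Ioi 0) := by
    simpa using integrableOn_cosh_pow_mul_exp 0 hr
  have i2 : IntegrableOn (fun t => Real.exp (-(r * Real.sinh t)) * t * (r * Real.cosh t))
      (Ioi 0) := by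
    refine Integrable.mono' ((integrableOn_cosh_pow_mul_exp 2 hr).const_mul r)
      (by fun_prop : Continuous _).aestronglyMeasurable ?_
    filter_upwards [ae_restrict_mem measurableSet_Ioi] with t (ht : 0 < t)
    have hc := Real.cosh_pos t
    have : t ≤ Real.cosh t := (Real.self_le_sinh_iff.2 ht.le).trans (Real.sinh_lt_cosh t).le
    rw [Real.norm_of_nonneg (by positivity)]
    calc _ ≤ Real.exp (-(r * Real.sinh t)) * Real.cosh t * (r * Real.cosh t) := by gcongr
      _ = _ := by ring
  have hd : ∀ t : ℝ, HasDerivAt (fun t => t * Real.exp (-(r * Real.sinh t)))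
      (Real.exp (-(r * Real.sinh t)) -
        Real.exp (-(r * Real.sinh t)) * t * (r * Real.cosh t)) t := fun t => by
    refine ((hasDerivAt_id t).mul ((Real.hasDerivAt_sinh t).const_mul r).neg.exp).congr_deriv ?_
    simp only [id, Pi.neg_apply]; ring
  have hparts := integral_Ioi_of_hasDerivAt_of_tendsto' (fun t (_ : t ∈ Ici (0 : ℝ)) => hd t)
    (i1.sub i2) hid
  rw [integral_sub i1 i2, zero_mul, sub_zero, sub_eq_zero] at hparts
  rw [hparts]
  have himg : ∀ s ⊆ Ici (0 : ℝ), (fun t => r * Real.sinh t) '' s ⊆ Ici 0 := by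
    rintro s hs _ ⟨t, ht, rfl⟩
    exact mul_nonneg hr.le (Real.sinh_nonneg_iff.2 (hs ht))
  have har := Real.continuous_arsinh
  have hsub := integral_comp_mul_deriv_Ioi (f := fun t => r * Real.sinh t)
    (f' := fun t => r * Real.cosh t) (g := fun u => Real.exp (-u) * Real.arsinh (u / r)) (a := 0)
    (by fun_prop : Continuous _).continuousOn (tendsto_sinh_atTop.const_mul_atTop hr)
    (fun t _ => ((Real.hasDerivAt_sinh t).const_mul r).hasDerivWithinAt)
    (by fun_prop : Continuous _).continuousOn
    (((integrableOn_Ici_iff_integrableOn_Ioi).2 (integrableOn_exp_neg_mul_arsinh hr)).mono_set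
      (himg _ subset_rfl)) ?_
  · simp only [Real.sinh_zero, mul_zero] at hsub
    rw [← hsub]
    congr 1; funext t
    simp [mul_div_cancel_left₀ _ hr.ne', Real.arsinh_sinh]
  · rw [integrableOn_Ici_iff_integrableOn_Ioi]
    refine i2.congr (ae_of_all _ fun t => ?_)
    simp [mul_div_cancel_left₀ _ hr.ne', Real.arsinh_sinh]

lemma arsinh_div_add_log {u r : ℝ} (hu : 0 < u) (hr : 0 < r) :
    Real.arsinh (u / r) + Real.log r = Real.log (u + √(r ^ 2 + u ^ 2)) := by
  have h1 : √(1 + (u / r) ^ 2) = √(r ^ 2 + u ^ 2) / r := by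
    rw [show 1 + (u / r) ^ 2 = (r ^ 2 + u ^ 2) / r ^ 2 by field_simp,
      Real.sqrt_div (by positivity), Real.sqrt_sq hr.le]
  rw [Real.arsinh, h1, ← Real.log_mul (by positivity) hr.ne']
  congr 1; field_simp

/-- After adding `log r` the integrand of `integral_exp_neg_mul_sinh` converges to
`e^{-u} log (2u)`, whose integral is `log 2 + Γ'(1)`. -/
lemma tendsto_integral_exp_neg_mul_sinh_add_log :
    Tendsto (fun r => (∫ t in Ioi 0, Real.exp (-(r * Real.sinh t))) + Real.log r) (𝓝[>] 0)
      (𝓝 (Real.log 2 - Real.eulerMascheroniConstant)) := by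
  have hlim : Tendsto (fun r : ℝ => ∫ u in Ioi (0 : ℝ),
      Real.exp (-u) * Real.log (u + √(r ^ 2 + u ^ 2))) (𝓝[>] 0)
      (𝓝 (∫ u in Ioi (0 : ℝ), Real.exp (-u) * (Real.log 2 + Real.log u))) := by
    refine tendsto_integral_filter_of_dominated_convergence
      (fun u => Real.exp (-u) * (2 * u ^ (-(1 / 2) : ℝ) + 3 * u))
      (Eventually.of_forall fun r => Measurable.aestronglyMeasurable (by fun_prop)) ?_
      integrableOn_exp_neg_mul_bound ?_
    · filter_upwards [Ioo_mem_nhdsGT one_pos] with r hr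
      filter_upwards [ae_restrict_mem measurableSet_Ioi] with u (hu : 0 < u)
      rw [norm_mul, Real.norm_of_nonneg (Real.exp_pos _).le, Real.norm_eq_abs]
      gcongr
      have hs0 : 0 ≤ √(r ^ 2 + u ^ 2) := Real.sqrt_nonneg _
      have hs1 : √(r ^ 2 + u ^ 2) ≤ 1 + u :=
        Real.sqrt_le_iff.2 ⟨by positivity, by nlinarith [hr.1, hr.2]⟩
      have hlo : Real.log u ≤ Real.log (u + √(r ^ 2 + u ^ 2)) :=
        Real.log_le_log hu (by linarith)
      have hhi : Real.log (u + √(r ^ 2 + u ^ 2)) ≤ 2 * u :=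
        (Real.log_le_sub_one_of_pos (by positivity)).trans (by linarith)
      have hab := abs_le.1 (abs_log_le hu)
      have := Real.rpow_nonneg hu.le (-(1 / 2) : ℝ)
      exact abs_le.2 ⟨by linarith [hab.1], by linarith⟩
    · filter_upwards [ae_restrict_mem measurableSet_Ioi] with u (hu : 0 < u)
      refine Tendsto.const_mul _ ?_
      have hc : ContinuousAt (fun r : ℝ => Real.log (u + √(r ^ 2 + u ^ 2))) 0 := by
        refine ContinuousAt.log (by fun_prop) ?_
        have := Real.sqrt_nonneg ((0 : ℝ) ^ 2 + u ^ 2)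
        positivity
      have h := hc.tendsto.mono_left (nhdsWithin_le_nhds (s := Ioi 0))
      rw [show u + √((0 : ℝ) ^ 2 + u ^ 2) = 2 * u by
        rw [zero_pow two_ne_zero, zero_add, Real.sqrt_sq hu.le]; ring,
        Real.log_mul two_ne_zero hu.ne'] at h
      exact h
  have e1 : ∫ u in Ioi (0 : ℝ), Real.exp (-u) * (Real.log 2 + Real.log u) =
      Real.log 2 - Real.eulerMascheroniConstant := by
    simp only [mul_add]
    rw [integral_add (integrableOn_exp_neg.mul_const _) integrableOn_exp_neg_mul_log,
      integral_exp_neg_mul_log, integral_mul_const, integral_exp_neg_Ioi_zero]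
    ring
  rw [e1] at hlim
  refine hlim.congr' ?_
  filter_upwards [self_mem_nhdsWithin] with r (hr : 0 < r)
  have e2 : Real.log r = ∫ u in Ioi (0 : ℝ), Real.exp (-u) * Real.log r := by
    rw [integral_mul_const, integral_exp_neg_Ioi_zero, one_mul]
  rw [integral_exp_neg_mul_sinh hr]
  conv_rhs => rw [e2]
  rw [← integral_add (integrableOn_exp_neg_mul_arsinh hr) (integrableOn_exp_neg.mul_const _)]
  refine setIntegral_congr_fun measurableSet_Ioi fun u (hu : 0 < u) => ?_
  rw [← mul_add, arsinh_div_add_log hu hr]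

lemma tendsto_planeWaveSum_sub_log :
    Tendsto (fun r => planeWaveSum 0 r - 2 * Complex.I *
      ((Real.log (r / 2) + Real.eulerMascheroniConstant : ℝ) : ℂ)) (𝓝[>] 0) (𝓝 Real.pi) := by
  have h1 := (continuous_integral_propagatingWave (w := fun _ => 1) (by fun_prop)).tendsto 0
  have e1 : (∫ θ in (-(Real.pi / 2))..(Real.pi / 2), 1 * propagatingWave 0 0 θ) = Real.pi := by
    simp [propagatingWave]
  rw [e1] at h1
  have h2 := (Complex.continuous_ofReal.tendsto _).comp tendsto_integral_exp_neg_mul_sinh_add_log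
  have h := (h1.mono_left (nhdsWithin_le_nhds (s := Ioi 0))).sub ((h2.sub_const
    ((Real.log 2 - Real.eulerMascheroniConstant : ℝ) : ℂ)).const_mul (2 * Complex.I))
  rw [sub_self, mul_zero, sub_zero] at h
  refine h.congr' ?_
  filter_upwards [self_mem_nhdsWithin] with r (hr : 0 < r)
  have e2 : evanescentPart 0 r = ((∫ t in Ioi 0, Real.exp (-(r * Real.sinh t)) : ℝ) : ℂ) := by
    rw [evanescentPart, ← integral_complex_ofReal]
    congr 1; funext t; simp [evanescentWave]
  rw [planeWaveSum_zero_left, e2, propagatingPart, Real.log_div hr.ne' two_ne_zero]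
  simp only [one_mul, Function.comp]
  push_cast
  ring

/-- The plane wave expansion of the Hankel function. -/
theorem planeWaveSum_eq_hankelH0 (a : ℝ) {h : ℝ} (hh : 0 < h) :
    planeWaveSum a h = Real.pi * hankelH0 (√(a ^ 2 + h ^ 2)) := by
  rw [planeWaveSum_eq_radial a hh]
  have hr : 0 < √(a ^ 2 + h ^ 2) := Real.sqrt_pos.2 (by positivity)
  generalize √(a ^ 2 + h ^ 2) = r at hr
  have hpi : (Real.pi : ℂ) ≠ 0 := by exact_mod_cast Real.pi_ne_zero
  have hD : SolvesBessel (fun r => planeWaveSum 0 r - Real.pi * hankelH0 r)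
      (fun r => planeWaveSumDeriv 0 r - Real.pi * hankelDeriv r) := fun r hr => by
    obtain ⟨p1, p2⟩ := solvesBessel_planeWaveSum r hr
    obtain ⟨q1, q2⟩ := solvesBessel_hankelH0 r hr
    refine ⟨p1.sub (q1.const_mul _), (p2.sub (q2.const_mul _)).congr_deriv ?_⟩
    ring
  have h0 : Tendsto (fun r => planeWaveSum 0 r - Real.pi * hankelH0 r) (𝓝[>] 0) (𝓝 0) := by
    have := tendsto_planeWaveSum_sub_log.sub (tendsto_hankelH0_sub_log.const_mul (Real.pi : ℂ))
    rw [mul_one, sub_self] at this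
    refine this.congr fun r => ?_
    field_simp
    ring
  have h1 : Tendsto (fun r => planeWaveSumDeriv 0 r - Real.pi * hankelDeriv r)
      (𝓝[>] 0) (𝓝 0) := by
    have := tendsto_planeWaveSumDeriv_sub_inv.sub
      (tendsto_hankelDeriv_sub_inv.const_mul (Real.pi : ℂ))
    rw [mul_zero, sub_self] at this
    refine this.congr fun r => ?_
    generalize ((1 / r : ℝ) : ℂ) = x
    field_simp
    ring
  exact sub_eq_zero.1 (hD.eq_zero h0 h1 hr)

/-! ### The horizontal Fourier transform of the normal derivative -/

/-- The vertical factor `e^{i β(ξ) h}`, `β(ξ) = √(1 - ξ²)`, `Im β ≥ 0`, of the plane wave with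
horizontal wave number `ξ`. As `Real.sqrt` vanishes on negative numbers, the first root is
present only for `|ξ| ≤ 1` and the second one only for `|ξ| ≥ 1`. -/
noncomputable def verticalFactor (h ξ : ℝ) : ℂ :=
  Complex.exp (Complex.I * ((h * √(1 - ξ ^ 2) : ℝ) : ℂ) - ((h * √(ξ ^ 2 - 1) : ℝ) : ℂ))

@[fun_prop]
lemma continuous_verticalFactor (h : ℝ) : Continuous (verticalFactor h) := by
  unfold verticalFactor; fun_prop

lemma norm_verticalFactor (h ξ : ℝ) :
    ‖verticalFactor h ξ‖ = Real.exp (-(h * √(ξ ^ 2 - 1))) := by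
  rw [verticalFactor, Complex.norm_exp, Complex.sub_re, Complex.mul_re, Complex.ofReal_im,
    Complex.ofReal_re, Complex.ofReal_re, Complex.I_re]
  simp

lemma verticalFactor_neg (h ξ : ℝ) : verticalFactor h (-ξ) = verticalFactor h ξ := by
  simp only [verticalFactor, neg_sq]

lemma verticalFactor_sin (h : ℝ) {θ : ℝ} (hθ : θ ∈ Icc (-(Real.pi / 2)) (Real.pi / 2)) :
    verticalFactor h (Real.sin θ) = Complex.exp (Complex.I * ((h * Real.cos θ : ℝ) : ℂ)) := by
  have h1 : √(1 - Real.sin θ ^ 2) = Real.cos θ := by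
    rw [← Real.cos_sq', Real.sqrt_sq (Real.cos_nonneg_of_mem_Icc hθ)]
  have h2 : √(Real.sin θ ^ 2 - 1) = 0 :=
    Real.sqrt_eq_zero'.2 (by linarith [Real.sin_sq_le_one θ])
  rw [verticalFactor, h1, h2]; simp

lemma verticalFactor_cosh (h : ℝ) {t : ℝ} (ht : 0 ≤ t) :
    verticalFactor h (Real.cosh t) = Complex.exp (-((h * Real.sinh t : ℝ) : ℂ)) := by
  have h1 : √(Real.cosh t ^ 2 - 1) = Real.sinh t := by
    rw [Real.cosh_sq, add_sub_cancel_right, Real.sqrt_sq (Real.sinh_nonneg_iff.2 ht)]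
  have h2 : √(1 - Real.cosh t ^ 2) = 0 :=
    Real.sqrt_eq_zero'.2 (by linarith [one_le_pow₀ (n := 2) (Real.one_le_cosh t)])
  rw [verticalFactor, h1, h2]; simp

lemma integrable_verticalFactor {h : ℝ} (hh : 0 < h) : Integrable (verticalFactor h) := by
  have h1 : Integrable fun ξ : ℝ => Real.exp h * Real.exp (-(h * |ξ|)) := by
    refine Integrable.const_mul ?_ _
    rw [← integrableOn_univ, ← Iic_union_Ioi (a := (0 : ℝ))]
    refine ((integrableOn_exp_mul_Iic hh 0).congr_fun (fun ξ (hξ : ξ ≤ 0) => ?_)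
      measurableSet_Iic).union
      ((exp_neg_integrableOn_Ioi 0 hh).congr_fun (fun ξ (hξ : 0 < ξ) => ?_) measurableSet_Ioi)
    · rw [abs_of_nonpos hξ]; ring_nf
    · rw [abs_of_pos hξ]; ring_nf
  refine h1.mono' (continuous_verticalFactor h).aestronglyMeasurable (ae_of_all _ fun ξ => ?_)
  rw [norm_verticalFactor, ← Real.exp_add]
  refine Real.exp_le_exp.2 ?_
  have : |ξ| - 1 ≤ √(ξ ^ 2 - 1) := by
    rcases le_total |ξ| 1 with h1 | h1
    · linarith [Real.sqrt_nonneg (ξ ^ 2 - 1)]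
    · refine Real.le_sqrt_of_sq_le ?_
      nlinarith [sq_abs ξ]
  nlinarith

/-- The normal derivative as a Fourier integral in the horizontal wave number, by the substitutions
`ξ = sin θ` and `ξ = ± cosh t`. The factor `1 / β(ξ)` of the field itself is absent here, so the
integrand is continuous. -/
lemma planeWaveSumDeriv_eq_integral (a : ℝ) {h : ℝ} (hh : 0 < h) :
    planeWaveSumDeriv a h =
      Complex.I * ∫ ξ : ℝ, verticalFactor h ξ * Complex.exp (Complex.I * ((a * ξ : ℝ) : ℂ)) := by
  set F : ℝ → ℂ := fun ξ => verticalFactor h ξ * Complex.exp (Complex.I * ((a * ξ : ℝ) : ℂ))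
  have hFc : Continuous F := by fun_prop
  have hF : Integrable F := by
    refine (integrable_verticalFactor hh).mul_bdd (c := 1)
      (by fun_prop : Continuous _).aestronglyMeasurable (ae_of_all _ fun ξ => ?_)
    rw [Complex.norm_exp]; simp
  have hpos : ∀ b : ℝ, ∀ G : ℝ → ℂ, Integrable G → Continuous G →
      (∀ t, 0 ≤ t → G (Real.cosh t) = evanescentWave b h t) →
      ∫ ξ in Ioi 1, G ξ = ∫ t in Ioi 0, (Real.sinh t : ℂ) * evanescentWave b h t := by
    intro b G hG hGc hGe
    have key := integral_deriv_smul_comp_Ioi (f := Real.cosh) (f' := Real.sinh) (g := G) (a := 0)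
      Real.continuous_cosh.continuousOn
      (tendsto_atTop_mono (fun t => (Real.sinh_lt_cosh t).le) tendsto_sinh_atTop)
      (fun t _ => (Real.hasDerivAt_cosh t).hasDerivWithinAt) hGc.continuousOn hG.integrableOn ?_
    · rw [Real.cosh_zero] at key
      rw [← key]
      refine setIntegral_congr_fun measurableSet_Ioi fun t (ht : 0 < t) => ?_
      simp [hGe t ht.le]
    · refine (integrableOn_Ici_iff_integrableOn_Ioi).2
        ((integrableOn_sinh_mul_evanescentWave b hh).congr_fun (fun t (ht : 0 < t) => ?_)
          measurableSet_Ioi)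
      simp [hGe t ht.le]
  have e1 : ∫ ξ in Ioi 1, F ξ = ∫ t in Ioi 0, (Real.sinh t : ℂ) * evanescentWave a h t := by
    refine hpos a F hF hFc fun t ht => ?_
    simp only [F]
    rw [verticalFactor_cosh h ht, evanescentWave, ← Complex.exp_add]
    congr 1; push_cast; ring
  have e2 : ∫ ξ in Iic (-1), F ξ =
      ∫ t in Ioi 0, (Real.sinh t : ℂ) * evanescentWave (-a) h t := by
    rw [← integral_comp_neg_Ioi]
    refine hpos (-a) (fun ξ => F (-ξ)) hF.comp_neg (by fun_prop) fun t ht => ?_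
    simp only [F]
    rw [verticalFactor_neg, verticalFactor_cosh h ht, evanescentWave, ← Complex.exp_add]
    congr 1; push_cast; ring
  have e3 : ∫ ξ in (-1)..1, F ξ = ∫ θ in (-(Real.pi / 2))..(Real.pi / 2),
      (Real.cos θ : ℂ) * propagatingWave a h θ := by
    have key := intervalIntegral.integral_deriv_smul_comp (f := Real.sin) (f' := Real.cos)
      (g := F) (a := -(Real.pi / 2)) (b := Real.pi / 2)
      (fun θ _ => Real.hasDerivAt_sin θ) Real.continuous_cos.continuousOn hFc
    rw [Real.sin_neg, Real.sin_pi_div_two] at key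
    rw [← key]
    refine intervalIntegral.integral_congr fun θ hθ => ?_
    rw [uIcc_of_le (by linarith [Real.pi_pos])] at hθ
    simp only [Function.comp, F]
    rw [verticalFactor_sin h hθ, propagatingWave, ← Complex.exp_add, Complex.real_smul]
    congr 2; push_cast; ring
  rw [← intervalIntegral.integral_Iic_add_Ioi (b := -1) hF.integrableOn hF.integrableOn,
    ← intervalIntegral.integral_interval_add_Ioi (b := 1) hF.integrableOn hF.integrableOn,
    e1, e2, e3, planeWaveSumDeriv]
  simp only [mul_assoc]
  rw [intervalIntegral.integral_const_mul]
  ring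

/-! ### Decay along horizontal lines -/

lemma hasDerivAt_sqrt_add_sq_right (a : ℝ) {h : ℝ} (hh : 0 < h) :
    HasDerivAt (fun h => √(a ^ 2 + h ^ 2)) (h / √(a ^ 2 + h ^ 2)) h := by
  have h1 : HasDerivAt (fun h : ℝ => a ^ 2 + h ^ 2) (2 * h) h := by
    simpa using (hasDerivAt_pow 2 h).const_add (a ^ 2)
  refine (h1.sqrt (by positivity)).congr_deriv ?_
  rw [mul_div_mul_left _ _ two_ne_zero]

lemma planeWaveSumDeriv_eq_hankelDeriv (a : ℝ) {h : ℝ} (hh : 0 < h) :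
    planeWaveSumDeriv a h = Real.pi * (((h / √(a ^ 2 + h ^ 2) : ℝ) : ℂ) *
      hankelDeriv (√(a ^ 2 + h ^ 2))) := by
  have hr : 0 < √(a ^ 2 + h ^ 2) := Real.sqrt_pos.2 (by positivity)
  have h1 := ((solvesBessel_hankelH0 _ hr).1.scomp h
    (hasDerivAt_sqrt_add_sq_right a hh)).const_mul (Real.pi : ℂ)
  have h2 : planeWaveSum a =ᶠ[𝓝 h] fun h => Real.pi * hankelH0 (√(a ^ 2 + h ^ 2)) := by
    filter_upwards [lt_mem_nhds hh] with s hs using planeWaveSum_eq_hankelH0 a hs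
  rw [(hasDerivAt_planeWaveSum a hh).unique (h1.congr_of_eventuallyEq h2), Complex.real_smul]

lemma continuousOn_hankelH0 : ContinuousOn hankelH0 (Ioi 0) := fun r hr =>
  (solvesBessel_hankelH0 r hr).1.continuousAt.continuousWithinAt

lemma continuousOn_hankelDeriv : ContinuousOn hankelDeriv (Ioi 0) := fun r hr =>
  (solvesBessel_hankelH0 r hr).2.continuousAt.continuousWithinAt

lemma continuous_planeWaveSum {h : ℝ} (hh : 0 < h) : Continuous fun a => planeWaveSum a h := by
  simp only [planeWaveSum_eq_hankelH0 _ hh]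
  exact continuous_const.mul (continuousOn_hankelH0.comp_continuous (by fun_prop) fun a =>
    Real.sqrt_pos.2 (by positivity))

lemma continuous_planeWaveSumDeriv {h : ℝ} (hh : 0 < h) :
    Continuous fun a => planeWaveSumDeriv a h := by
  simp only [planeWaveSumDeriv_eq_hankelDeriv _ hh]
  have hr : ∀ a, 0 < √(a ^ 2 + h ^ 2) := fun a => Real.sqrt_pos.2 (by positivity)
  exact continuous_const.mul ((Complex.continuous_ofReal.comp (continuous_const.div (by fun_prop)
    fun a => (hr a).ne')).mul (continuousOn_hankelDeriv.comp_continuous (by fun_prop) hr))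

lemma exists_norm_planeWaveSum_le (h : ℝ) : ∃ C, ∀ a, ‖planeWaveSum a h‖ ≤ C := by
  have hP : ∀ a, ‖propagatingPart a h‖ ≤ 1 * |Real.pi / 2 - -(Real.pi / 2)| := fun a =>
    intervalIntegral.norm_integral_le_of_norm_le_const fun θ _ => (norm_propagatingWave a h θ).le
  have hE : ∀ a, ‖evanescentPart a h‖ ≤ ∫ t in Ioi 0, Real.exp (-(h * Real.sinh t)) := fun a => by
    refine (norm_integral_le_integral_norm _).trans_eq ?_
    simp only [norm_evanescentWave]
  refine ⟨_, fun a => (norm_sub_le _ _).trans (add_le_add (hP a) (?_ : _ ≤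
    (∫ t in Ioi 0, Real.exp (-(h * Real.sinh t))) +
      ∫ t in Ioi 0, Real.exp (-(h * Real.sinh t))))⟩
  rw [norm_mul, Complex.norm_I, one_mul]
  exact (norm_add_le _ _).trans (add_le_add (hE a) (hE (-a)))

/-- The normal derivative decays like `|a| ^ (-3/2)`: one half from the decay of `H₀⁽¹⁾'`, one from
the cosine of the angle between the ray and the normal. -/
lemma integrable_planeWaveSumDeriv {h : ℝ} (hh : 0 < h) :
    Integrable fun a => planeWaveSumDeriv a h := by
  obtain ⟨C, hC⟩ := solvesBessel_hankelH0.exists_decay hh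
  have hC0 : 0 ≤ C := le_trans (by positivity) (hC h le_rfl).1
  have h1 : Integrable fun a : ℝ => (1 + ‖a‖ ^ 2) ^ (-(3 / 2 : ℝ) / 2) :=
    integrable_rpow_neg_one_add_norm_sq (by simp; norm_num)
  refine ((h1.comp_div hh.ne').const_mul (Real.pi * √(C / h))).mono'
    (continuous_planeWaveSumDeriv hh).aestronglyMeasurable (ae_of_all _ fun a => ?_)
  set q : ℝ := 1 + ‖a / h‖ ^ 2
  have hq : 0 < q := by positivity
  set ρ := √(a ^ 2 + h ^ 2)
  have hρ : ρ = h * √q := by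
    nth_rw 1 [← Real.sqrt_sq hh.le]
    rw [← Real.sqrt_mul (by positivity)]
    simp only [ρ]
    congr 1
    simp only [q, Real.norm_eq_abs, sq_abs]
    field_simp
    ring
  have hρh : h ≤ ρ := Real.le_sqrt_of_sq_le (by nlinarith [sq_nonneg a])
  have hsq : 0 < √q := Real.sqrt_pos.2 hq
  have hd : ‖hankelDeriv ρ‖ ≤ √(C / h) * q ^ (-(1 / 4) : ℝ) := by
    refine le_of_sq_le_sq ?_ (by positivity)
    have e : (q ^ (-(1 / 4) : ℝ)) ^ 2 = (√q)⁻¹ := by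
      rw [← Real.rpow_natCast, ← Real.rpow_mul hq.le, Real.sqrt_eq_rpow, ← Real.rpow_neg hq.le]
      norm_num
    rw [mul_pow, Real.sq_sqrt (by positivity), e]
    have := (hC ρ hρh).2
    rw [hρ] at this ⊢
    rw [← div_eq_mul_inv, div_div, le_div_iff₀ (by positivity)]
    linarith
  rw [planeWaveSumDeriv_eq_hankelDeriv a hh, norm_mul, norm_mul, Complex.norm_real,
    Complex.norm_real, Real.norm_of_nonneg Real.pi_pos.le, Real.norm_of_nonneg (by positivity)]
  have e1 : h / ρ = q ^ (-(1 / 2) : ℝ) := by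
    rw [hρ, Real.rpow_neg hq.le, ← Real.sqrt_eq_rpow]; field_simp
  have e2 : q ^ (-(3 / 2 : ℝ) / 2) = q ^ (-(1 / 2) : ℝ) * q ^ (-(1 / 4) : ℝ) := by
    rw [← Real.rpow_add hq]; norm_num
  rw [e1, e2]
  calc _ ≤ Real.pi * (q ^ (-(1 / 2) : ℝ) * (√(C / h) * q ^ (-(1 / 4) : ℝ))) := by gcongr
    _ = _ := by ring

open scoped FourierTransform in
/-- Fourier inversion: the horizontal Fourier transform of the normal derivative is, up to a
factor, the vertical factor. -/
lemma integral_planeWaveSumDeriv_mul_exp {h : ℝ} (hh : 0 < h) (ξ : ℝ) :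
    ∫ a : ℝ, planeWaveSumDeriv a h * Complex.exp (-(Complex.I * ((a * ξ : ℝ) : ℂ))) =
      2 * Real.pi * Complex.I * verticalFactor h ξ := by
  have hinv : ∀ x : ℝ, 𝓕⁻ (verticalFactor h) x =
      -Complex.I * planeWaveSumDeriv (2 * Real.pi * x) h := fun x => by
    rw [planeWaveSumDeriv_eq_integral _ hh, Real.fourierInv_eq', ← mul_assoc, neg_mul,
      Complex.I_mul_I, neg_neg, one_mul]
    congr 1; funext η
    rw [smul_eq_mul, mul_comm]
    congr 2
    simp only [RCLike.inner_apply, conj_trivial]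
    push_cast; ring
  have hpi : (2 * Real.pi : ℝ) ≠ 0 := by positivity
  have hint : Integrable (𝓕 (verticalFactor h)) := by
    have h1 : Integrable fun x : ℝ => -Complex.I * planeWaveSumDeriv (2 * Real.pi * -x) h :=
      (((integrable_planeWaveSumDeriv hh).comp_mul_left' hpi).comp_neg).const_mul _
    refine h1.congr (ae_of_all _ fun x => ?_)
    simp only
    rw [← hinv, Real.fourierInv_eq_fourier_neg, neg_neg]
  have key := congrFun ((continuous_verticalFactor h).fourier_fourierInv_eq
    (integrable_verticalFactor hh) hint) ξ
  rw [Real.fourier_real_eq_integral_exp_smul] at key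
  have e : ∀ x : ℝ, Complex.exp (((-2 * Real.pi * x * ξ : ℝ) : ℂ) * Complex.I) •
      𝓕⁻ (verticalFactor h) x = -Complex.I * (fun a => planeWaveSumDeriv a h *
        Complex.exp (-(Complex.I * ((a * ξ : ℝ) : ℂ)))) (2 * Real.pi * x) := fun x => by
    rw [hinv, smul_eq_mul]
    have : ((-2 * Real.pi * x * ξ : ℝ) : ℂ) * Complex.I =
      -(Complex.I * ((2 * Real.pi * x * ξ : ℝ) : ℂ)) := by push_cast; ring
    rw [this]; ring
  simp only [e] at key
  rw [integral_const_mul, Measure.integral_comp_mul_left (fun a => planeWaveSumDeriv a h *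
        Complex.exp (-(Complex.I * ((a * ξ : ℝ) : ℂ)))), abs_of_pos (by positivity),
    Complex.real_smul] at key
  rw [← key]
  generalize ∫ a : ℝ, planeWaveSumDeriv a h * Complex.exp (-(Complex.I * ((a * ξ : ℝ) : ℂ))) = J
  have hpi' : (Real.pi : ℂ) ≠ 0 := by exact_mod_cast Real.pi_ne_zero
  push_cast
  field_simp
  rw [Complex.I_sq]; ring

/-! ### The pairing of a normal derivative with a field -/

lemma norm_exp_neg_I_mul (x : ℝ) : ‖Complex.exp (-(Complex.I * (x : ℂ)))‖ = 1 := by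
  rw [Complex.norm_exp]; simp

/-- Fubini's theorem for an integrable function against a superposition of exponentials. -/
lemma integral_mul_integral_exp {g : ℝ → ℂ} (hg : Integrable g) {μ : Measure ℝ} [SFinite μ]
    {w : ℝ → ℂ} (hw : Integrable w μ) {ξ : ℝ → ℝ} (hξ : Continuous ξ) :
    Integrable (fun t => g t *
      ∫ s, w s * Complex.exp (-(Complex.I * ((t * ξ s : ℝ) : ℂ))) ∂μ) ∧
    ∫ t, g t * ∫ s, w s * Complex.exp (-(Complex.I * ((t * ξ s : ℝ) : ℂ))) ∂μ =
      ∫ s, w s * (∫ t, g t * Complex.exp (-(Complex.I * ((t * ξ s : ℝ) : ℂ)))) ∂μ := by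
  have hprod : Integrable (fun p : ℝ × ℝ => g p.1 * w p.2 *
      Complex.exp (-(Complex.I * ((p.1 * ξ p.2 : ℝ) : ℂ)))) (volume.prod μ) :=
    (hg.mul_prod hw).mul_bdd (c := 1) (by fun_prop : Continuous _).aestronglyMeasurable
      (ae_of_all _ fun p => (norm_exp_neg_I_mul _).le)
  have e1 : ∀ t, g t * ∫ s, w s * Complex.exp (-(Complex.I * ((t * ξ s : ℝ) : ℂ))) ∂μ =
      ∫ s, g t * w s * Complex.exp (-(Complex.I * ((t * ξ s : ℝ) : ℂ))) ∂μ := fun t => by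
    rw [← integral_const_mul]; simp only [mul_assoc]
  have e2 : ∀ s, w s * (∫ t, g t * Complex.exp (-(Complex.I * ((t * ξ s : ℝ) : ℂ)))) =
      ∫ t, g t * w s * Complex.exp (-(Complex.I * ((t * ξ s : ℝ) : ℂ))) := fun s => by
    rw [← integral_const_mul]; congr 1; funext t; ring
  simp only [e1, e2]
  exact ⟨hprod.integral_prod_left, integral_integral_swap hprod⟩

lemma conj_propagatingPart (a h : ℝ) :
    conj (propagatingPart a h) = propagatingPart (-a) (-h) := by
  rw [propagatingPart, propagatingPart, intervalIntegral.integral_of_le (by linarith [Real.pi_pos]),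
    intervalIntegral.integral_of_le (by linarith [Real.pi_pos]), ← integral_conj]
  simp only [conj_propagatingWave]

lemma conj_evanescentPart (a h : ℝ) :
    conj (evanescentPart a h) = evanescentPart (-a) h := by
  rw [evanescentPart, evanescentPart, ← integral_conj]
  simp only [conj_evanescentWave]

lemma conj_planeWaveSum (a h : ℝ) :
    conj (planeWaveSum a h) = propagatingPart (-a) (-h) +
      Complex.I * (evanescentPart (-a) h + evanescentPart a h) := by
  rw [planeWaveSum, map_sub, map_mul, map_add, Complex.conj_I, conj_propagatingPart,
    conj_evanescentPart, conj_evanescentPart, neg_neg]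
  ring

lemma integral_planeWaveSumDeriv_sub_mul_exp {h : ℝ} (hh : 0 < h) (p ξ : ℝ) :
    ∫ t : ℝ, planeWaveSumDeriv (t - p) h * Complex.exp (-(Complex.I * ((t * ξ : ℝ) : ℂ))) =
      2 * Real.pi * Complex.I *
        (Complex.exp (-(Complex.I * ((p * ξ : ℝ) : ℂ))) * verticalFactor h ξ) := by
  have e : ∀ t : ℝ, planeWaveSumDeriv (t - p) h * Complex.exp (-(Complex.I * ((t * ξ : ℝ) : ℂ))) =
      Complex.exp (-(Complex.I * ((p * ξ : ℝ) : ℂ))) * (fun a => planeWaveSumDeriv a h *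
        Complex.exp (-(Complex.I * ((a * ξ : ℝ) : ℂ)))) (t - p) := fun t => by
    rw [mul_left_comm]
    rw [← Complex.exp_add]
    congr 2; push_cast; ring
  simp only [e]
  rw [integral_const_mul, integral_sub_right_eq_self (fun a => planeWaveSumDeriv a h *
        Complex.exp (-(Complex.I * ((a * ξ : ℝ) : ℂ)))), integral_planeWaveSumDeriv_mul_exp hh]
  ring

lemma integrable_planeWaveSumDeriv_mul_conj {h h' : ℝ} (hh : 0 < h) (hh' : 0 < h') (p q : ℝ) :
    Integrable fun t => planeWaveSumDeriv (t - p) h * conj (planeWaveSum (t - q) h') := by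
  obtain ⟨C, hC⟩ := exists_norm_planeWaveSum_le h'
  have hc := continuous_planeWaveSum hh'
  refine ((integrable_planeWaveSumDeriv hh).comp_sub_right p).mul_bdd (c := C)
    (Complex.continuous_conj.comp (hc.comp (by fun_prop))).aestronglyMeasurable
    (ae_of_all _ fun t => ?_)
  rw [RCLike.norm_conj]
  exact hC _

/-- In the pairing of a normal derivative with a field, horizontal wave numbers do not interact.
The propagating contribution depends on the difference of the two heights, the evanescent one on
their sum. -/
lemma integral_planeWaveSumDeriv_mul_conj {h h' : ℝ} (hh : 0 < h) (hh' : 0 < h') (p q : ℝ) :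
    ∫ t, planeWaveSumDeriv (t - p) h * conj (planeWaveSum (t - q) h') =
      2 * Real.pi * Complex.I * (propagatingPart (q - p) (h - h') +
        Complex.I * (evanescentPart (q - p) (h + h') + evanescentPart (p - q) (h + h'))) := by
  have hg : Integrable fun t => planeWaveSumDeriv (t - p) h :=
    (integrable_planeWaveSumDeriv hh).comp_sub_right p
  have hle : -(Real.pi / 2) ≤ Real.pi / 2 := by linarith [Real.pi_pos]
  obtain ⟨i1, f1⟩ := integral_mul_integral_exp hg
    (μ := volume.restrict (Ioc (-(Real.pi / 2)) (Real.pi / 2))) (w := propagatingWave q (-h'))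
    ((continuous_propagatingWave q (-h')).integrableOn_Ioc) Real.continuous_sin
  obtain ⟨i2, f2⟩ := integral_mul_integral_exp hg
    (μ := volume.restrict (Ioi 0)) (w := evanescentWave q h')
    (integrableOn_evanescentWave q hh') Real.continuous_cosh
  obtain ⟨i3, f3⟩ := integral_mul_integral_exp hg
    (μ := volume.restrict (Ioi 0)) (w := evanescentWave (-q) h')
    (integrableOn_evanescentWave (-q) hh') (ξ := fun s => -Real.cosh s) Real.continuous_cosh.neg
  have e1 : ∀ t, ∫ θ in Ioc (-(Real.pi / 2)) (Real.pi / 2), propagatingWave q (-h') θ *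
      Complex.exp (-(Complex.I * ((t * Real.sin θ : ℝ) : ℂ))) =
      propagatingPart (-(t - q)) (-h') := fun t => by
    rw [propagatingPart, intervalIntegral.integral_of_le hle]
    congr 1; funext θ
    rw [propagatingWave, propagatingWave, ← Complex.exp_add]
    congr 1; push_cast; ring
  have e2 : ∀ t, ∫ s in Ioi 0, evanescentWave q h' s *
      Complex.exp (-(Complex.I * ((t * Real.cosh s : ℝ) : ℂ))) =
      evanescentPart (-(t - q)) h' := fun t => by
    rw [evanescentPart]
    congr 1; funext s
    rw [evanescentWave, evanescentWave, ← Complex.exp_add]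
    congr 1; push_cast; ring
  have e3 : ∀ t, ∫ s in Ioi 0, evanescentWave (-q) h' s *
      Complex.exp (-(Complex.I * ((t * -Real.cosh s : ℝ) : ℂ))) =
      evanescentPart (t - q) h' := fun t => by
    rw [evanescentPart]
    congr 1; funext s
    rw [evanescentWave, evanescentWave, ← Complex.exp_add]
    congr 1; push_cast; ring
  have g1 : ∫ θ in Ioc (-(Real.pi / 2)) (Real.pi / 2), propagatingWave q (-h') θ *
      (2 * Real.pi * Complex.I * (Complex.exp (-(Complex.I * ((p * Real.sin θ : ℝ) : ℂ))) *
        verticalFactor h (Real.sin θ))) =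
      2 * Real.pi * Complex.I * propagatingPart (q - p) (h - h') := by
    rw [propagatingPart, intervalIntegral.integral_of_le hle, ← integral_const_mul]
    refine setIntegral_congr_fun measurableSet_Ioc fun θ hθ => ?_
    rw [verticalFactor_sin h (Ioc_subset_Icc_self hθ), mul_left_comm, propagatingWave,
      propagatingWave, ← Complex.exp_add, ← Complex.exp_add]
    congr 2; push_cast; ring
  have g2 : ∫ s in Ioi 0, evanescentWave q h' s *
      (2 * Real.pi * Complex.I * (Complex.exp (-(Complex.I * ((p * Real.cosh s : ℝ) : ℂ))) *
        verticalFactor h (Real.cosh s))) =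
      2 * Real.pi * Complex.I * evanescentPart (q - p) (h + h') := by
    rw [evanescentPart, ← integral_const_mul]
    refine setIntegral_congr_fun measurableSet_Ioi fun s (hs : 0 < s) => ?_
    rw [verticalFactor_cosh h hs.le, mul_left_comm, evanescentWave, evanescentWave,
      ← Complex.exp_add, ← Complex.exp_add]
    congr 2; push_cast; ring
  have g3 : ∫ s in Ioi 0, evanescentWave (-q) h' s *
      (2 * Real.pi * Complex.I * (Complex.exp (-(Complex.I * ((p * -Real.cosh s : ℝ) : ℂ))) *
        verticalFactor h (-Real.cosh s))) =
      2 * Real.pi * Complex.I * evanescentPart (p - q) (h + h') := by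
    rw [evanescentPart, ← integral_const_mul]
    refine setIntegral_congr_fun measurableSet_Ioi fun s (hs : 0 < s) => ?_
    rw [verticalFactor_neg, verticalFactor_cosh h hs.le, mul_left_comm, evanescentWave,
      evanescentWave, ← Complex.exp_add, ← Complex.exp_add]
    congr 2; push_cast; ring
  simp only [e1, e2, e3, integral_planeWaveSumDeriv_sub_mul_exp hh, g1, g2, g3] at i1 i2 i3 f1 f2 f3
  have hsum : ∀ t, planeWaveSumDeriv (t - p) h * conj (planeWaveSum (t - q) h') =
      planeWaveSumDeriv (t - p) h * propagatingPart (-(t - q)) (-h') +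
      Complex.I * (planeWaveSumDeriv (t - p) h * evanescentPart (-(t - q)) h' +
        planeWaveSumDeriv (t - p) h * evanescentPart (t - q) h') := fun t => by
    rw [conj_planeWaveSum]; ring
  have i23 : Integrable fun t => Complex.I *
      (planeWaveSumDeriv (t - p) h * evanescentPart (-(t - q)) h' +
        planeWaveSumDeriv (t - p) h * evanescentPart (t - q) h') := (i2.add i3).const_mul _
  simp only [hsum]
  rw [integral_add i1 i23, integral_const_mul, integral_add i2 i3, f1, f2, f3]
  ring

/-- The antisymmetrised pairing: the evanescent contributions are symmetric and cancel, the
propagating ones add up. -/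
lemma integral_planeWaveSum_antisymm {h h' : ℝ} (hh : 0 < h) (hh' : 0 < h') (p q : ℝ) :
    Integrable (fun t => planeWaveSumDeriv (t - p) h * conj (planeWaveSum (t - q) h') -
      planeWaveSum (t - p) h * conj (planeWaveSumDeriv (t - q) h')) ∧
    ∫ t, (planeWaveSumDeriv (t - p) h * conj (planeWaveSum (t - q) h') -
      planeWaveSum (t - p) h * conj (planeWaveSumDeriv (t - q) h')) =
      4 * Real.pi * Complex.I * propagatingPart (q - p) (h - h') := by
  have i1 := integrable_planeWaveSumDeriv_mul_conj hh hh' p q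
  have i2 := integrable_planeWaveSumDeriv_mul_conj hh' hh q p
  have hconj : ∀ t, planeWaveSum (t - p) h * conj (planeWaveSumDeriv (t - q) h') =
      conj (planeWaveSumDeriv (t - q) h' * conj (planeWaveSum (t - p) h)) := fun t => by
    rw [map_mul, Complex.conj_conj, mul_comm]
  have i3 : Integrable fun t =>
      conj (planeWaveSumDeriv (t - q) h' * conj (planeWaveSum (t - p) h)) :=
    Complex.conjCLE.toContinuousLinearMap.integrable_comp i2
  simp only [hconj]
  refine ⟨i1.sub i3, ?_⟩
  rw [integral_sub i1 i3, integral_conj, integral_planeWaveSumDeriv_mul_conj hh hh',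
    integral_planeWaveSumDeriv_mul_conj hh' hh]
  simp only [map_mul, map_add, conj_propagatingPart, conj_evanescentPart, Complex.conj_I,
    Complex.conj_ofReal, neg_sub, map_ofNat, add_comm h' h]
  ring

/-! ### The fundamental solution on a horizontal line -/

lemma hasDerivAt_plane {f g : ℝ → ℝ} {f' g' t : ℝ} (hf : HasDerivAt f f' t)
    (hg : HasDerivAt g g' t) :
    HasDerivAt (fun t => (!₂[f t, g t] : Plane)) !₂[f', g'] t := by
  have h : HasDerivAt (fun t => ![f t, g t]) ![f', g'] t := by
    rw [hasDerivAt_pi]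
    intro i
    fin_cases i
    · exact hf
    · exact hg
  exact (PiLp.hasFDerivAt_toLp 2 _).comp_hasDerivAt t h

lemma norm_plane (x : Plane) : ‖x‖ = √(x 0 ^ 2 + x 1 ^ 2) := by
  rw [EuclideanSpace.norm_eq, Fin.sum_univ_two, Real.norm_eq_abs, Real.norm_eq_abs, sq_abs, sq_abs]

lemma norm_deriv_lineCurve (H t : ℝ) : ‖deriv (lineCurve H) t‖ = 1 := by
  have h : HasDerivAt (lineCurve H) !₂[1, 0] t :=
    hasDerivAt_plane (hasDerivAt_id t) (hasDerivAt_const t H)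
  rw [h.deriv, norm_plane]; simp

lemma norm_deriv_circleCurve (θ : ℝ) : ‖deriv circleCurve θ‖ = 1 := by
  have h : HasDerivAt circleCurve !₂[-Real.sin θ, Real.cos θ] θ :=
    hasDerivAt_plane (Real.hasDerivAt_cos θ) (Real.hasDerivAt_sin θ)
  rw [h.deriv, norm_plane]; simp

lemma Phi_eq_planeWaveSum {k : ℝ} (hk : 0 < k) {x y : Plane} (h : y 1 < x 1) :
    Phi k x y = Complex.I / (4 * Real.pi) *
      planeWaveSum (k * (x 0 - y 0)) (k * (x 1 - y 1)) := by
  have hn : √((k * (x 0 - y 0)) ^ 2 + (k * (x 1 - y 1)) ^ 2) = k * ‖x - y‖ := by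
    rw [norm_plane, mul_pow, mul_pow, ← mul_add, Real.sqrt_mul (by positivity),
      Real.sqrt_sq hk.le]
    rfl
  rw [planeWaveSum_eq_hankelH0 _ (mul_pos hk (sub_pos.2 h)), hn, Phi]
  have hpi : (Real.pi : ℂ) ≠ 0 := by exact_mod_cast Real.pi_ne_zero
  field_simp

lemma differentiableAt_Phi {k : ℝ} (hk : 0 < k) {x y : Plane} (h : x ≠ y) :
    DifferentiableAt ℝ (fun w => Phi k w y) x := by
  have hne : x - y ≠ 0 := sub_ne_zero.2 h
  have hd : DifferentiableAt ℝ (fun w : Plane => k * ‖w - y‖) x :=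
    ((differentiableAt_id.sub_const y).norm ℝ hne).const_mul k
  have hH := (solvesBessel_hankelH0 (k * ‖x - y‖)
    (mul_pos hk (norm_pos_iff.2 hne))).1.differentiableAt
  exact (hH.comp x hd).const_mul _

lemma differentiableAt_conj_Phi {k : ℝ} (hk : 0 < k) {x y : Plane} (h : x ≠ y) :
    DifferentiableAt ℝ (fun w => conj (Phi k w y)) x :=
  Complex.conjCLE.differentiableAt.comp x (differentiableAt_Phi hk h)

lemma ne_of_apply_one_lt {x y : Plane} (h : y 1 < x 1) : x ≠ y := fun e => by
  rw [e] at h; exact lt_irrefl _ h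

lemma normalDeriv_Phi {k : ℝ} (hk : 0 < k) {x y : Plane} (h : y 1 < x 1) :
    normalDeriv (fun w => Phi k w y) x = Complex.I / (4 * Real.pi) *
      (k * planeWaveSumDeriv (k * (x 0 - y 0)) (k * (x 1 - y 1))) := by
  have hl : HasDerivAt (fun s : ℝ => x + s • nu) nu 0 := by
    simpa using ((hasDerivAt_id (0 : ℝ)).smul_const nu).const_add x
  have h1 : HasDerivAt (fun s : ℝ => Phi k (x + s • nu) y)
      (normalDeriv (fun w => Phi k w y) x) 0 := by
    have hf : HasFDerivAt (fun w => Phi k w y) (fderiv ℝ (fun w => Phi k w y) x)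
        (x + (0 : ℝ) • nu) := by
      rw [zero_smul, add_zero]
      exact (differentiableAt_Phi hk (ne_of_apply_one_lt h)).hasFDerivAt
    exact hf.comp_hasDerivAt 0 hl
  have hc : HasDerivAt (fun s : ℝ => k * (x 1 + s - y 1)) k 0 := by
    simpa using (((hasDerivAt_id (0 : ℝ)).const_add (x 1)).sub_const (y 1)).const_mul k
  have h2 : HasDerivAt (fun s : ℝ => Complex.I / (4 * Real.pi) *
      planeWaveSum (k * (x 0 - y 0)) (k * (x 1 + s - y 1)))
      (Complex.I / (4 * Real.pi) *
        (k * planeWaveSumDeriv (k * (x 0 - y 0)) (k * (x 1 - y 1)))) 0 := by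
    have hs : HasDerivAt (planeWaveSum (k * (x 0 - y 0)))
        (planeWaveSumDeriv (k * (x 0 - y 0)) (k * (x 1 - y 1))) (k * (x 1 + 0 - y 1)) := by
      rw [add_zero]; exact hasDerivAt_planeWaveSum _ (mul_pos hk (sub_pos.2 h))
    have := (hs.scomp (0 : ℝ) hc).const_mul (Complex.I / (4 * Real.pi : ℂ))
    rwa [Complex.real_smul] at this
  refine h1.unique (h2.congr_of_eventuallyEq ?_)
  filter_upwards [lt_mem_nhds (show y 1 - x 1 < 0 by linarith)] with s hs
  have e0 : (x + s • nu) 0 = x 0 := by simp [nu]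
  have e1 : (x + s • nu) 1 = x 1 + s := by simp [nu]
  rw [Phi_eq_planeWaveSum hk (by rw [e1]; linarith), e0, e1]

/-- Complex conjugation commutes with real differentiation. -/
lemma normalDeriv_conj_Phi {k : ℝ} (hk : 0 < k) {x y : Plane} (h : y 1 < x 1) :
    normalDeriv (fun w => conj (Phi k w y)) x = conj (normalDeriv (fun w => Phi k w y) x) := by
  have h1 := Complex.conjCLE.toContinuousLinearMap.hasFDerivAt.comp x
    (differentiableAt_Phi hk (ne_of_apply_one_lt h)).hasFDerivAt
  rw [normalDeriv, normalDeriv]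
  change fderiv ℝ (Complex.conjCLE ∘ fun w => Phi k w y) x nu = _
  erw [h1.fderiv]
  rfl

lemma kirchhoffIntegrand_lineCurve {k : ℝ} (hk : 0 < k) {H : ℝ} {y z : Plane} (hy : y 1 < H)
    (hz : z 1 < H) (t : ℝ) :
    kirchhoffIntegrand k y z (lineCurve H t) = (k / (16 * Real.pi ^ 2) : ℂ) *
      (planeWaveSumDeriv (k * t - k * y 0) (k * (H - y 1)) *
          conj (planeWaveSum (k * t - k * z 0) (k * (H - z 1))) -
        planeWaveSum (k * t - k * y 0) (k * (H - y 1)) *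
          conj (planeWaveSumDeriv (k * t - k * z 0) (k * (H - z 1)))) := by
  have e0 : lineCurve H t 0 = t := rfl
  have e1 : lineCurve H t 1 = H := rfl
  have hy' : y 1 < lineCurve H t 1 := hy
  have hz' : z 1 < lineCurve H t 1 := hz
  rw [kirchhoffIntegrand, normalDeriv_conj_Phi hk hz', normalDeriv_Phi hk hy',
    normalDeriv_Phi hk hz', Phi_eq_planeWaveSum hk hy', Phi_eq_planeWaveSum hk hz', e0, e1,
    ← mul_sub k t, ← mul_sub k t]
  simp only [map_mul, map_div₀, Complex.conj_I, Complex.conj_ofReal, map_ofNat]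
  have hpi : (Real.pi : ℂ) ≠ 0 := by exact_mod_cast Real.pi_ne_zero
  field_simp
  rw [Complex.I_sq]
  ring

lemma arcIntegral_circleCurve (k : ℝ) (y z : Plane) :
    arcIntegral circleCurve (Ioo 0 Real.pi)
      (fun v => Complex.exp (Complex.I * (k : ℂ) * ((inner ℝ v (z - y) : ℝ) : ℂ))) =
    propagatingPart (k * (z 0 - y 0)) (k * (z 1 - y 1)) := by
  have h := intervalIntegral.integral_comp_sub_left (a := 0) (b := Real.pi)
    (propagatingWave (k * (z 0 - y 0)) (k * (z 1 - y 1))) (Real.pi / 2)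
  rw [sub_zero, show Real.pi / 2 - Real.pi = -(Real.pi / 2) by ring] at h
  rw [propagatingPart, ← h, intervalIntegral.integral_of_le Real.pi_pos.le,
    integral_Ioc_eq_integral_Ioo, arcIntegral]
  congr 1; funext θ
  have hin : inner ℝ (circleCurve θ) (z - y) =
      (z 0 - y 0) * Real.cos θ + (z 1 - y 1) * Real.sin θ := by
    rw [PiLp.inner_apply, Fin.sum_univ_two]
    simp [circleCurve]
  rw [norm_deriv_circleCurve, one_smul, hin, propagatingWave, Real.sin_pi_div_two_sub,
    Real.cos_pi_div_two_sub]
  congr 1; push_cast; ring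

end Helmholtz2D

open Helmholtz2D in
theorem lemma3p4 (k : ℝ) (hk : 0 < k) (H : ℝ) (y z : Helmholtz2D.Plane)
    (hy : y 1 < H) (hz : z 1 < H) :
    (∀ x ∈ Helmholtz2D.line H,
      DifferentiableAt ℝ (fun w => Helmholtz2D.Phi k w y) x ∧
      DifferentiableAt ℝ (fun w => conj (Helmholtz2D.Phi k w z)) x) ∧
    Helmholtz2D.ArcIntegrable (Helmholtz2D.lineCurve H) Set.univ
      (Helmholtz2D.kirchhoffIntegrand k y z) ∧
    Helmholtz2D.arcIntegral (Helmholtz2D.lineCurve H) Set.univ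
      (Helmholtz2D.kirchhoffIntegrand k y z) =
    Complex.I / (4 * (Real.pi : ℂ)) *
      Helmholtz2D.arcIntegral Helmholtz2D.circleCurve (Set.Ioo 0 Real.pi)
        (fun v => Complex.exp (Complex.I * (k : ℂ) * ((inner ℝ v (z - y) : ℝ) : ℂ))) := by
  obtain ⟨hint, heq⟩ := integral_planeWaveSum_antisymm (mul_pos hk (sub_pos.2 hy))
    (mul_pos hk (sub_pos.2 hz)) (k * y 0) (k * z 0)
  refine ⟨fun x (hx : x 1 = H) => ⟨differentiableAt_Phi hk (ne_of_apply_one_lt (hx ▸ hy)),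
    differentiableAt_conj_Phi hk (ne_of_apply_one_lt (hx ▸ hz))⟩, ?_, ?_⟩
  · simp only [ArcIntegrable, norm_deriv_lineCurve, one_smul, integrableOn_univ,
      kirchhoffIntegrand_lineCurve hk hy hz]
    exact (hint.comp_mul_left' hk.ne').const_mul _
  · rw [arcIntegral_circleCurve]
    simp only [arcIntegral, norm_deriv_lineCurve, one_smul, Measure.restrict_univ,
      kirchhoffIntegrand_lineCurve hk hy hz]
    rw [integral_const_mul, Measure.integral_comp_mul_left (fun s =>
      planeWaveSumDeriv (s - k * y 0) (k * (H - y 1)) *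
          conj (planeWaveSum (s - k * z 0) (k * (H - z 1))) -
        planeWaveSum (s - k * y 0) (k * (H - y 1)) *
          conj (planeWaveSumDeriv (s - k * z 0) (k * (H - z 1)))), heq,
      abs_of_pos (inv_pos.2 hk), Complex.real_smul, ← mul_sub k, ← mul_sub k,
      sub_sub_sub_cancel_left]
    have hpi : (Real.pi : ℂ) ≠ 0 := by exact_mod_cast Real.pi_ne_zero
    have hk' : (k : ℂ) ≠ 0 := by exact_mod_cast hk.ne'
    push_cast
    field_simp
    norm_num
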